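/- **Theorem 3.2.** Let $\kappa$ be a cardinal. Then $\kappa$ is $\Pi^1_1$ reflecting if and only if $\kappa$ is (strongly) inaccessible and has the extension property. Here $\kappa$ is *$\Pi^1_1$ reflecting* if $\kappa$ is inaccessible and for every $A\subseteq V_\kappa$ that is first-order definable over $(V_\kappa,\in)$ with parameters from $V_\kappa$, and every $\Pi^1_1$ sentence $\Phi$ (a sentence $\forall Y_1\cdots\forall Y_k\,\varphi$, where the $Y_i$ range over subsets of the domain and $\varphi$ is first-order in the symbols $\in$, $A$, $Y_1,\dots,Y_k$) with $(V_\kappa,\in,A)\models\Phi$, there is an ordinal $\alpha<\kappa$ with $(V_\alpha,\in,A\cap V_\alpha)\models\Phi$. The cardinal $\kappa$ has the *extension property* if for every $n<\omega$ and every $A\subseteq V_\kappa$ that is first-order definable over $(V_\kappa,\in)$ with parameters from $V_\kappa$, there are a transitive set $X$ and a set $A^X\subseteq X$ such that $\kappa\in X$ and $(V_\kappa,\in,A)\prec_n(X,\in,A^X)$, that is, $(V_\kappa,\in,A)$ is a substructure of $(X,\in,A^X)$ and both structures satisfy the same $\Sigma_n$ formulas (Lévy hierarchy in the language with $\in$ and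 a unary predicate for $A$) at all tuples from $V_\kappa$. -/

import Mathlib

open FirstOrder FirstOrder.Language ZFSet

universe u

namespace SetReflection

/-- Relation symbols: the binary symbol `∈` and one unary predicate symbol for each `p : P`. -/
inductive SetRel (P : Type) : ℕ → Type
  | mem : SetRel P 2
  | pred (p : P) : SetRel P 1

/-- The language of set theory with additional unary predicate symbols indexed by `P`. -/
def setLang (P : Type) : FirstOrder.Language.{0, 0} :=
  ⟨fun _ => Empty, SetRel P⟩

/-- The universe of the structure `(D, ∈, I p)_{p : P}`: the elements of the set `D`.
The interpretation `I` of the predicate symbols is recorded in the type. -/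
@[ext]
structure Str {P : Type} (D : ZFSet.{u}) (_I : P → ZFSet.{u}) : Type (u + 1) where
  /-- the underlying set -/
  val : ZFSet.{u}
  /-- it is an element of `D` -/
  mem : val ∈ D

/-- The structure `(D, ∈, I p)_{p : P}`: `∈` is true membership, and the predicate symbol `p`
holds of `x ∈ D` iff `x ∈ I p`. -/
instance instStructureStr {P : Type} (D : ZFSet.{u}) (I : P → ZFSet.{u}) :
    (setLang P).Structure (Str D I) where
  funMap := fun f _ => Empty.elim f
  RelMap := fun {_} r =>
    match r with
    | SetRel.mem => fun xs => (xs 0).val ∈ (xs 1).val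
    | SetRel.pred p => fun xs => (xs 0).val ∈ I p

/-- `A` is a subset of `D` that is first-order definable over `(D, ∈)` with parameters
from `D`. -/
def IsDefinableSubset (D A : ZFSet.{u}) : Prop :=
  A ⊆ D ∧
    (Set.univ : Set (Str D (Empty.elim : Empty → ZFSet.{u}))).Definable₁ (setLang Empty)
      {x | x.val ∈ A}

/-- `(D, ∈, A) ⊨ ∀ Y₀ ⋯ ∀ Yₖ₋₁ φ`, where the second-order variables `Yᵢ` range over all subsets of
`D` and `φ` is a first-order sentence in the symbols `∈`, `A`, `Y₀, …, Yₖ₋₁`. Thus `φ` encodes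
an arbitrary `Π¹₁` sentence in the language of `(D, ∈, A)`. -/
def SatPi11 (D A : ZFSet.{u}) {k : ℕ} (φ : (setLang (Unit ⊕ Fin k)).Sentence) : Prop :=
  ∀ Y : Fin k → ZFSet.{u}, (∀ i, Y i ⊆ D) → Str D (Sum.elim (fun _ : Unit => A) Y) ⊨ φ

/-- `κ` is `Π¹₁` reflecting. -/
def IsPi11Reflecting (κ : Cardinal.{u}) : Prop :=
  κ.IsInaccessible ∧
    ∀ A : ZFSet.{u}, IsDefinableSubset (V_ κ.ord) A →
      ∀ (k : ℕ) (φ : (setLang (Unit ⊕ Fin k)).Sentence),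
        SatPi11 (V_ κ.ord) A φ → ∃ α < κ.ord, SatPi11 (V_ α) (A ∩ V_ α) φ

/-- The formula `x ∈ y`, for variables `x`, `y`. -/
def memFormula {P : Type} {m : ℕ} (x y : Fin m) : (setLang P).BoundedFormula Empty m :=
  Relations.boundedFormula₂ (L := setLang P) (SetRel.mem : SetRel P 2)
    (Term.var (Sum.inr x)) (Term.var (Sum.inr y))

/-- `Δ₀` formulas: built from atomic formulas by propositional connectives and
bounded quantifiers `∀ x ∈ y`. (Here `⊥` and `→` generate all connectives, and
`∃ x ∈ y, φ` is `¬ ∀ x ∈ y, ¬ φ`. The free variables of a formula are numbered by `Fin m`, and a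
quantifier binds the variable with the last number.) -/
inductive IsDelta0 {P : Type} : ∀ {m : ℕ}, (setLang P).BoundedFormula Empty m → Prop
  | falsum {m : ℕ} : IsDelta0 (BoundedFormula.falsum : (setLang P).BoundedFormula Empty m)
  | equal {m : ℕ} (s t : (setLang P).Term (Empty ⊕ Fin m)) :
      IsDelta0 (BoundedFormula.equal s t)
  | rel {m l : ℕ} (R : (setLang P).Relations l) (ts : Fin l → (setLang P).Term (Empty ⊕ Fin m)) :
      IsDelta0 (BoundedFormula.rel R ts)
  | imp {m : ℕ} {φ ψ : (setLang P).BoundedFormula Empty m} :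
      IsDelta0 φ → IsDelta0 ψ → IsDelta0 (φ.imp ψ)
  | ball {m : ℕ} (y : Fin m) {φ : (setLang P).BoundedFormula Empty (m + 1)} :
      IsDelta0 φ → IsDelta0 (((memFormula (Fin.last m) y.castSucc).imp φ).all)

mutual

/-- The `Σₙ` formulas of the Lévy hierarchy: `Σ₀ = Δ₀`, and a `Σₙ₊₁` formula is a (possibly empty)
block of existential quantifiers followed by a `Πₙ` formula. -/
inductive IsSigma {P : Type} : ℕ → ∀ {m : ℕ}, (setLang P).BoundedFormula Empty m → Prop
  | zero {m : ℕ} {φ : (setLang P).BoundedFormula Empty m} : IsDelta0 φ → IsSigma 0 φ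
  | ofPi {n m : ℕ} {φ : (setLang P).BoundedFormula Empty m} : IsPi n φ → IsSigma (n + 1) φ
  | ex {n m : ℕ} {φ : (setLang P).BoundedFormula Empty (m + 1)} :
      IsSigma (n + 1) φ → IsSigma (n + 1) φ.ex

/-- The `Πₙ` formulas of the Lévy hierarchy: `Π₀ = Δ₀`, and a `Πₙ₊₁` formula is a (possibly empty)
block of universal quantifiers followed by a `Σₙ` formula. -/
inductive IsPi {P : Type} : ℕ → ∀ {m : ℕ}, (setLang P).BoundedFormula Empty m → Prop
  | zero {m : ℕ} {φ : (setLang P).BoundedFormula Empty m} : IsDelta0 φ → IsPi 0 φ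
  | ofSigma {n m : ℕ} {φ : (setLang P).BoundedFormula Empty m} : IsSigma n φ → IsPi (n + 1) φ
  | all {n m : ℕ} {φ : (setLang P).BoundedFormula Empty (m + 1)} :
      IsPi (n + 1) φ → IsPi (n + 1) φ.all

end

/-- `(D, ∈, A) ≺ₙ (X, ∈, B)`: the first structure is a `Σₙ`-elementary substructure of the second,
where `Σₙ` refers to the language with `∈` and one unary predicate symbol. -/
def SigmaElementary (n : ℕ) (D A X B : ZFSet.{u}) : Prop :=
  ∃ h : D ⊆ X,
    ∀ (m : ℕ) (φ : (setLang Unit).BoundedFormula Empty m), IsSigma n φ →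
      ∀ v : Fin m → Str D (fun _ : Unit => A),
        φ.Realize Empty.elim v ↔
          φ.Realize (M := Str X (fun _ : Unit => B)) Empty.elim
            (fun i => ⟨(v i).val, h (v i).mem⟩)

/-- `κ` has the extension property. -/
def HasExtensionProperty (κ : Cardinal.{u}) : Prop :=
  ∀ (n : ℕ) (A : ZFSet.{u}), IsDefinableSubset (V_ κ.ord) A →
    ∃ X B : ZFSet.{u}, X.IsTransitive ∧ B ⊆ X ∧ κ.ord.toZFSet ∈ X ∧
      SigmaElementary n (V_ κ.ord) A X B

end SetReflection

-- From extensions to reflection. Suppose `(V_κ, ∈, A)` satisfies the `Π¹₁` sentence `Φ`, but no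
-- `V_α` with `α < κ` does. For `α < κ` every subset of `V_α` belongs to `V_κ`, so "no level of the
-- hierarchy satisfies `Φ`" is a first-order sentence true in `(V_κ, ∈, A)`. So is "every ordinal is
-- the set of ordinals of some level". Both pass to a transitive `X` with `κ ∈ X`, once `n` is large
-- enough for a prenex form. In `X` the ordinal `κ` then yields a level, which can only be `V_κ`,
-- since `V_κ ⊆ X`. Thus `X` believes that `Φ` fails at `V_κ`, although `Φ` holds there for all `Y ⊆
-- V_κ`, in particular for those in `X`. This is `isPi11Reflecting_of_hasExtensionProperty`.
--
-- From reflection to extensions, one sentence at a time (`IsPi11Reflecting.exists_extension`). A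
-- transitive extension containing `κ` can be coded by subsets of `V_κ`: a relation `E`, an
-- embedding `J` of `V_κ` and predicates `B`. Well-foundedness of `E` is first-order over `V_κ`,
-- because `κ` is regular and uncountable and so every descending sequence is an element of `V_κ`.
-- Hence "there is no code of an extension satisfying `φ`" is `Π¹₁`. If it held at `κ`, it would
-- reflect to some `V_o` with `o < κ`. But an elementary substructure of `V_κ` of size `|V_o|`
-- containing `V_o ∪ {o}`, copied onto `V_o`, is such a code (`exists_isCode`). So a code exists
-- over `V_κ`, and its transitive collapse is the extension (`exists_extension_of_isCode`).
--
-- To get all `Σₙ` formulas from a single sentence, a truth predicate `T` for formulas with at most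
-- `n` quantifier blocks is added. It is definable over `(V_κ, ∈, A)` by `realize_fTruth`, hence
-- over `(V_κ, ∈)`. The sentence to be preserved says that `T` is this truth predicate. The
-- extension of `T` to `X` is then truth in `X`, and it agrees with `T` on pairs in `V_κ`; this
-- agreement is `Σₙ`-elementarity.

namespace SetReflection

/-! ### Formulas of set theory with named variables

The formulas below have free variables in an arbitrary type `ι`; a quantifier binds the variable
`none : Option ι`. -/

section Formulas

variable {P : Type} {ι : Type}

/-- The valuation extending `v` by the value `x` for the variable `none`. -/
def vcons {M : Type*} (x : M) (v : ι → M) : Option ι → M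
  | none => x
  | some i => v i

@[simp] lemma vcons_none {M : Type*} (x : M) (v : ι → M) : vcons x v none = x := rfl

@[simp] lemma vcons_some {M : Type*} (x : M) (v : ι → M) (i : ι) : vcons x v (some i) = v i := rfl

/-- The formula `x ∈ y`. -/
def fMem (x y : ι) : (setLang P).Formula ι :=
  Relations.formula₂ (L := setLang P) (SetRel.mem : SetRel P 2) (Term.var x) (Term.var y)

/-- The formula `x = y`. -/
def fEq (x y : ι) : (setLang P).Formula ι :=
  Term.equal (Term.var x) (Term.var y)

/-- The formula `p(x)`. -/
def fPred (p : P) (x : ι) : (setLang P).Formula ι :=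
  Relations.formula₁ (L := setLang P) (SetRel.pred p : SetRel P 1) (Term.var x)

/-- Universal quantification over the variable `none`. -/
def fAll (φ : (setLang P).Formula (Option ι)) : (setLang P).Formula ι :=
  (BoundedFormula.relabel (n := 1)
    (fun o : Option ι => o.elim (Sum.inr 0) Sum.inl) φ : (setLang P).BoundedFormula ι 1).all

/-- Existential quantification over the variable `none`. -/
def fEx (φ : (setLang P).Formula (Option ι)) : (setLang P).Formula ι :=
  ∼ (fAll (∼ φ))

lemma realize_fAll' {M : Type*} [(setLang P).Structure M] (φ : (setLang P).Formula (Option ι))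
    (v : ι → M) : (fAll φ).Realize v ↔ ∀ x : M, φ.Realize (vcons x v) := by
  unfold fAll Formula.Realize
  rw [BoundedFormula.realize_all]
  refine forall_congr' fun x => ?_
  rw [BoundedFormula.realize_relabel]
  have : (Sum.elim v (Fin.snoc (default : Fin 0 → M) x ∘ Fin.castAdd 0) ∘
      fun o : Option ι => o.elim (Sum.inr 0) Sum.inl) = vcons x v := by
    funext o
    cases o <;> simp [vcons, Fin.snoc]
  rw [this]
  exact iff_of_eq (congrArg _ (Subsingleton.elim _ _))

variable {D : ZFSet.{u}} {I : P → ZFSet.{u}} (v : ι → Str D I)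

lemma Str.forall {p : Str D I → Prop} : (∀ x, p x) ↔ ∀ x (h : x ∈ D), p ⟨x, h⟩ :=
  ⟨fun h x hx => h ⟨x, hx⟩, fun h x => h x.val x.mem⟩

@[simp] lemma realize_fMem (x y : ι) : (fMem (P := P) x y).Realize v ↔ (v x).val ∈ (v y).val := by
  simp only [fMem]
  rfl

@[simp] lemma realize_fPred (p : P) (x : ι) : (fPred p x).Realize v ↔ (v x).val ∈ I p := by
  simp only [fPred]
  rfl

@[simp] lemma realize_fEq (x y : ι) : (fEq (P := P) x y).Realize v ↔ (v x).val = (v y).val := by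
  simp [fEq, Formula.realize_equal, Str.ext_iff]

@[simp] lemma realize_fAll (φ : (setLang P).Formula (Option ι)) :
    (fAll φ).Realize v ↔ ∀ x (h : x ∈ D), φ.Realize (vcons ⟨x, h⟩ v) := by
  rw [realize_fAll', Str.forall]

@[simp] lemma realize_fEx (φ : (setLang P).Formula (Option ι)) :
    (fEx φ).Realize v ↔ ∃ x, ∃ (h : x ∈ D), φ.Realize (vcons ⟨x, h⟩ v) := by
  simp [fEx, Formula.realize_not]

@[simp] lemma realize_fImp (φ ψ : (setLang P).Formula ι) :
    Formula.Realize (φ.imp ψ) v ↔ (φ.Realize v → ψ.Realize v) := Formula.realize_imp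

@[simp] lemma realize_fIff (φ ψ : (setLang P).Formula ι) :
    Formula.Realize (φ.iff ψ) v ↔ (φ.Realize v ↔ ψ.Realize v) := Formula.realize_iff

/-- Bounded universal quantification `∀ w ∈ y`. -/
def fBAll (y : ι) (φ : (setLang P).Formula (Option ι)) : (setLang P).Formula ι :=
  fAll ((fMem none (some y)).imp φ)

/-- Bounded existential quantification `∃ w ∈ y`. -/
def fBEx (y : ι) (φ : (setLang P).Formula (Option ι)) : (setLang P).Formula ι :=
  fEx (fMem none (some y) ⊓ φ)

@[simp] lemma realize_fBAll (y : ι) (φ : (setLang P).Formula (Option ι)) :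
    (fBAll y φ).Realize v ↔ ∀ x (h : x ∈ D), x ∈ (v y).val → φ.Realize (vcons ⟨x, h⟩ v) := by
  simp [fBAll]

@[simp] lemma realize_fBEx (y : ι) (φ : (setLang P).Formula (Option ι)) :
    (fBEx y φ).Realize v ↔
      ∃ x, ∃ (h : x ∈ D), x ∈ (v y).val ∧ φ.Realize (vcons ⟨x, h⟩ v) := by
  simp [fBEx]

/-- The formula `z = {x, y}`. -/
def fUPair (x y z : ι) : (setLang P).Formula ι :=
  fMem x z ⊓ (fMem y z ⊓ fBAll z (fEq none (some x) ⊔ fEq none (some y)))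

/-- The formula `z = (x, y)`. -/
def fPair (x y z : ι) : (setLang P).Formula ι :=
  fEx (fUPair (some x) (some x) none ⊓ fEx (fUPair (some (some x)) (some (some y)) none ⊓
    fUPair (some none) none (some (some z))))

/-- The formula `(x, y) ∈ S`. -/
def fPairMem (x y S : ι) : (setLang P).Formula ι :=
  fBEx S (fPair (some x) (some y) none)

/-- The formula `(k, (x, y)) ∈ S`. -/
def fTripleMem (k x y S : ι) : (setLang P).Formula ι :=
  fEx (fPair (some x) (some y) none ⊓ fPairMem (some k) none (some S))

/-- The formula `(k, (i, (x, y))) ∈ S`. -/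
def fQuadMem (k i x y S : ι) : (setLang P).Formula ι :=
  fEx (fPair (some x) (some y) none ⊓ fTripleMem (some k) (some i) none (some S))

/-- The formula `p((x, y))`. -/
def fPairPred (p : P) (x y : ι) : (setLang P).Formula ι :=
  fEx (fPair (some x) (some y) none ⊓ fPred p none)

/-- The formula `x ⊆ y`. -/
def fSub (x y : ι) : (setLang P).Formula ι :=
  fBAll x (fMem none (some y))

/-- The formula expressing that `x` is an ordinal. -/
def fOrd (x : ι) : (setLang P).Formula ι :=
  fBAll x (fSub none (some x)) ⊓
    fBAll x (fBAll none (fBAll none (fMem none (some (some none)))))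

section Transitive

variable {v} (hD : D.IsTransitive)
include hD

@[simp] lemma realize_fUPair {x y z : ι} :
    (fUPair (P := P) x y z).Realize v ↔ (v z).val = {(v x).val, (v y).val} := by
  simp only [fUPair, Formula.realize_inf, realize_fMem, realize_fBAll, Formula.realize_sup,
    realize_fEq, vcons_none, vcons_some]
  constructor
  · rintro ⟨h1, h2, h3⟩
    ext w
    rw [ZFSet.mem_pair]
    exact ⟨fun h => h3 w (hD.subset_of_mem (v z).mem h) h, by rintro (rfl | rfl) <;> assumption⟩
  · intro h
    rw [h]
    simp

lemma realize_fPair {x y z : ι} :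
    (fPair (P := P) x y z).Realize v ↔ (v z).val = pair (v x).val (v y).val := by
  simp only [fPair, Formula.realize_inf, realize_fEx, realize_fUPair hD, vcons_none, vcons_some,
    pair, pair_eq_singleton]
  constructor
  · rintro ⟨a, _, rfl, b, _, rfl, h⟩
    exact h
  · intro h
    have ha : ({(v x).val} : ZFSet) ∈ (v z).val := by rw [h]; simp
    have hb : ({(v x).val, (v y).val} : ZFSet) ∈ (v z).val := by rw [h]; simp
    exact ⟨_, hD.subset_of_mem (v z).mem ha, rfl, _, hD.subset_of_mem (v z).mem hb, rfl, h⟩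

lemma realize_fPairMem {x y S : ι} :
    (fPairMem (P := P) x y S).Realize v ↔ pair (v x).val (v y).val ∈ (v S).val := by
  simp only [fPairMem, realize_fBEx, realize_fPair hD, vcons_none, vcons_some]
  exact ⟨by rintro ⟨_, _, h, rfl⟩; exact h,
    fun h => ⟨_, hD.subset_of_mem (v S).mem h, h, rfl⟩⟩

omit hD in
lemma mem_of_pair_mem_left {x y : ZFSet.{u}} (hD : D.IsTransitive) (h : pair x y ∈ D) : x ∈ D :=
  hD.subset_of_mem (hD.subset_of_mem h (show {x} ∈ pair x y by simp [pair])) (by simp)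

omit hD in
lemma mem_of_pair_mem_right {x y : ZFSet.{u}} (hD : D.IsTransitive) (h : pair x y ∈ D) : y ∈ D :=
  hD.subset_of_mem (hD.subset_of_mem h (show {x, y} ∈ pair x y by simp [pair])) (by simp)

lemma realize_fTripleMem {k x y S : ι} :
    (fTripleMem (P := P) k x y S).Realize v ↔
      pair (v k).val (pair (v x).val (v y).val) ∈ (v S).val := by
  simp only [fTripleMem, Formula.realize_inf, realize_fEx, realize_fPair hD, realize_fPairMem hD,
    vcons_none, vcons_some]
  exact ⟨by rintro ⟨_, _, rfl, h⟩; exact h,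
    fun h => ⟨_, mem_of_pair_mem_right hD (hD.subset_of_mem (v S).mem h), rfl, h⟩⟩

lemma realize_fQuadMem {k i x y S : ι} :
    (fQuadMem (P := P) k i x y S).Realize v ↔
      pair (v k).val (pair (v i).val (pair (v x).val (v y).val)) ∈ (v S).val := by
  simp only [fQuadMem, Formula.realize_inf, realize_fEx, realize_fPair hD, realize_fTripleMem hD,
    vcons_none, vcons_some]
  exact ⟨by rintro ⟨_, _, rfl, h⟩; exact h,
    fun h => ⟨_, mem_of_pair_mem_right hD (mem_of_pair_mem_right hD
      (hD.subset_of_mem (v S).mem h)), rfl, h⟩⟩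

lemma realize_fPairPred {p : P} {x y : ι} :
    (fPairPred p x y).Realize v ↔
      pair (v x).val (v y).val ∈ D ∧ pair (v x).val (v y).val ∈ I p := by
  simp only [fPairPred, Formula.realize_inf, realize_fEx, realize_fPair hD, realize_fPred,
    vcons_none, vcons_some]
  exact ⟨by rintro ⟨_, h', rfl, h⟩; exact ⟨h', h⟩, fun h => ⟨_, h.1, rfl, h.2⟩⟩

lemma realize_fSub {x y : ι} : (fSub (P := P) x y).Realize v ↔ (v x).val ⊆ (v y).val := by
  simp only [fSub, realize_fBAll, realize_fMem, vcons_none, vcons_some]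
  exact ⟨fun h w hw => h w (hD.subset_of_mem (v x).mem hw) hw, fun h w _ hw => h hw⟩

lemma realize_fOrd {x : ι} : (fOrd (P := P) x).Realize v ↔ (v x).val.IsOrdinal := by
  simp only [fOrd, Formula.realize_inf, realize_fBAll, realize_fSub hD, realize_fMem, vcons_none,
    vcons_some]
  have key : ∀ {y z}, z ∈ D → y ∈ z → y ∈ D := fun hz hy => hD.subset_of_mem hz hy
  constructor
  · rintro ⟨h1, h2⟩
    refine ⟨fun y hy => h1 y (key (v x).mem hy) hy, ?_⟩
    intro a b c hab hbc hc
    have hcD := key (v x).mem hc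
    have hbD := key hcD hbc
    exact h2 c hcD hc b hbD hbc a (key hbD hab) hab
  · rintro h
    exact ⟨fun y _ hy => h.subset_of_mem hy, fun c _ hc b _ hbc a _ hab => h.mem_trans' hab hbc hc⟩

end Transitive

end Formulas

/-! ### Interpretations -/

section Interpretations

variable {P P' Q : Type}

/-- The number of the variable which is the given term. -/
def varIdx {m : ℕ} : (setLang P).Term (Empty ⊕ Fin m) → Fin m
  | Term.var (Sum.inr i) => i
  | Term.var (Sum.inl e) => e.elim
  | Term.func f _ => Empty.elim f

lemma var_varIdx {m : ℕ} (t : (setLang P).Term (Empty ⊕ Fin m)) :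
    t = Term.var (Sum.inr (varIdx t)) := by
  match t with
  | Term.var (Sum.inr i) => rfl
  | Term.var (Sum.inl e) => exact e.elim
  | Term.func f _ => exact Empty.elim f

/-- Formulas interpreting a structure for `setLang P` in a structure for `setLang P'`, with
parameters indexed by `Q`. -/
structure Interp (P P' Q : Type) where
  /-- the domain -/
  dom : ∀ {ι : Type}, (Q → ι) → ι → (setLang P').Formula ι
  /-- membership -/
  mem : ∀ {ι : Type}, (Q → ι) → ι → ι → (setLang P').Formula ι
  /-- the predicates -/
  pred : ∀ {ι : Type}, P → (Q → ι) → ι → (setLang P').Formula ι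

namespace Interp

/-- The translation of atomic formulas. -/
def trRel (T : Interp P P' Q) {ι : Type} (q : Q → ι) :
    ∀ {l : ℕ}, SetRel P l → (Fin l → ι) → (setLang P').Formula ι
  | _, SetRel.mem, xs => T.mem q (xs 0) (xs 1)
  | _, SetRel.pred p, xs => T.pred p q (xs 0)

/-- The translation of formulas along an interpretation. -/
def tr (T : Interp P P' Q) : ∀ {m : ℕ}, (setLang P).BoundedFormula Empty m →
    ∀ {ι : Type}, (Q → ι) → (Fin m → ι) → (setLang P').Formula ι
  | _, .falsum, _, _, _ => ⊥
  | _, .equal s t, _, _, xs => fEq (xs (varIdx s)) (xs (varIdx t))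
  | _, .rel R ts, _, q, xs => T.trRel q R (fun i => xs (varIdx (ts i)))
  | _, .imp φ ψ, _, q, xs => (T.tr φ q xs).imp (T.tr ψ q xs)
  | _, .all φ, _, q, xs => fAll ((T.dom (some ∘ q) none).imp
      (T.tr φ (some ∘ q) (Fin.snoc (α := fun _ => Option _) (some ∘ xs) none)))

/-- `T` interprets `M` in `Str D I`, via `e` and with the parameters `q`. -/
structure Interprets (T : Interp P P' Q) {M : Type*} [(setLang P).Structure M] {D : ZFSet.{u}}
    {I : P' → ZFSet.{u}} (e : M → Str D I) (q : Q → Str D I) : Prop where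
  inj : Function.Injective e
  dom : ∀ {ι : Type} (v : ι → Str D I) (r : Q → ι) (x : ι), v ∘ r = q →
    ((T.dom r x).Realize v ↔ ∃ a, e a = v x)
  mem : ∀ {ι : Type} (v : ι → Str D I) (r : Q → ι) (x y : ι) (a b : M), v ∘ r = q →
    e a = v x → e b = v y → ((T.mem r x y).Realize v ↔
      Structure.RelMap (L := setLang P) (SetRel.mem : SetRel P 2) ![a, b])
  pred : ∀ {ι : Type} (p : P) (v : ι → Str D I) (r : Q → ι) (x : ι) (a : M), v ∘ r = q →
    e a = v x → ((T.pred p r x).Realize v ↔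
      Structure.RelMap (L := setLang P) (SetRel.pred p : SetRel P 1) ![a])

/-- This is used twice: to relativize a sentence to a set, and to evaluate a sentence in a structure
coded by second-order variables. -/
theorem Interprets.realize_tr {T : Interp P P' Q} {M : Type*} [(setLang P).Structure M]
    {D : ZFSet.{u}} {I : P' → ZFSet.{u}} {e : M → Str D I} {q : Q → Str D I}
    (h : T.Interprets e q) {m : ℕ} (φ : (setLang P).BoundedFormula Empty m) {ι : Type}
    (v : ι → Str D I) (r : Q → ι) (xs : Fin m → ι) (w : Empty → M) (zs : Fin m → M)
    (hr : v ∘ r = q) (hz : ∀ i, e (zs i) = v (xs i)) :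
    (T.tr φ r xs).Realize v ↔ φ.Realize w zs := by
  induction φ generalizing ι with
  | falsum => exact Iff.rfl
  | equal s t =>
    rw [var_varIdx s, var_varIdx t]
    simp only [tr, realize_fEq, BoundedFormula.Realize, Term.realize_var, Sum.elim_inr]
    rw [← Str.ext_iff]
    change v (xs (varIdx s)) = v (xs (varIdx t)) ↔ _
    rw [← hz, ← hz, h.inj.eq_iff]
  | @rel n l R ts =>
    have : ∀ i, (ts i).realize (Sum.elim w zs) = zs (varIdx (ts i)) := fun i => by
      conv_lhs => rw [var_varIdx (ts i)]
      simp
    simp only [tr, BoundedFormula.Realize, this]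
    change (T.trRel r (R : SetRel P l) _).Realize v ↔ _
    cases (R : SetRel P l) with
    | mem =>
      simp only [trRel]
      rw [h.mem v r _ _ _ _ hr (hz _) (hz _)]
      refine iff_of_eq (congrArg _ ?_)
      funext i
      fin_cases i <;> rfl
    | pred p =>
      simp only [trRel]
      rw [h.pred p v r _ _ hr (hz _)]
      refine iff_of_eq (congrArg _ ?_)
      funext i
      fin_cases i
      rfl
  | imp φ ψ ih1 ih2 =>
    simp only [tr, realize_fImp, BoundedFormula.realize_imp]
    rw [ih1 v r xs zs hr hz, ih2 v r xs zs hr hz]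
  | all φ ih =>
    simp only [tr, realize_fAll', BoundedFormula.realize_all, realize_fImp]
    have hr' : ∀ x, vcons x v ∘ some ∘ r = q := fun x => hr
    have hz' : ∀ a i, e ((Fin.snoc zs a : Fin _ → M) i) =
        vcons (e a) v ((Fin.snoc (α := fun _ => Option ι) (some ∘ xs) none) i) := by
      intro a i
      refine Fin.lastCases ?_ (fun i => ?_) i
      · simp
      · simp [hz]
    constructor
    · intro H a
      exact (ih (vcons (e a) v) _ _ _ (hr' _) (hz' a)).1
        (H (e a) ((h.dom _ _ _ (hr' _)).2 ⟨a, rfl⟩))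
    · intro H x hx
      obtain ⟨a, ha⟩ := (h.dom _ _ _ (hr' _)).1 hx
      rw [vcons_none] at ha
      subst ha
      exact (ih (vcons (e a) v) _ _ _ (hr' _) (hz' a)).2 (H a)

end Interp

end Interpretations

/-! ### The cumulative hierarchy -/

section Hierarchy

variable {o : Ordinal.{u}} {κ : Cardinal.{u}}

lemma pair_mem_vonNeumann (ho : Order.IsSuccPrelimit o) {x y : ZFSet.{u}} (hx : x ∈ V_ o)
    (hy : y ∈ V_ o) : pair x y ∈ V_ o := by
  simp only [mem_vonNeumann, pair, rank_pair, rank_singleton, max_lt_iff] at *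
  have := fun a (h : a < o) => ho.succ_lt h
  simp_all

/-- Here uncountability and regularity of `κ` enter: countably many ranks below `κ` are bounded
below `κ`. This is what makes well-foundedness first-order over `V_κ`. -/
lemma range_mem_vonNeumann (hκ : κ.IsInaccessible) {α : Type} [Countable α]
    {f : α → ZFSet.{u}} (hf : ∀ a, f a ∈ V_ κ.ord) : range f ∈ V_ κ.ord := by
  have hlim := Cardinal.isSuccLimit_ord hκ.aleph0_lt.le
  rw [mem_vonNeumann, rank_range]
  refine Ordinal.lift_iSup_lt_of_lt_cof ?_ fun a => hlim.succ_lt (mem_vonNeumann.1 (hf a))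
  rw [Ordinal.lift_uzero, hκ.isRegular.cof_ord]
  exact (Cardinal.lift_le_aleph0.2 (Cardinal.mk_le_aleph0 (α := α))).trans_lt hκ.aleph0_lt

lemma IsInaccessible.isSuccLimit_ord (hκ : κ.IsInaccessible) : Order.IsSuccLimit κ.ord :=
  Cardinal.isSuccLimit_ord hκ.aleph0_lt.le

lemma toZFSet_mem_vonNeumann {a : Ordinal.{u}} : a.toZFSet ∈ V_ o ↔ a < o := by
  rw [mem_vonNeumann, Ordinal.rank_toZFSet]

end Hierarchy

-- Levels of the hierarchy, defined without ordinals

section Levels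

variable {P ι : Type}

/-- The formula expressing that `v` is a level of the cumulative hierarchy. -/
def fLevel (v : ι) : (setLang P).Formula ι :=
  fEx (fBAll none (fAll (BoundedFormula.iff (fMem none (some none))
      (fBEx (some (some none)) (fMem none (some (some none)) ⊓ fSub (some none) none)))) ⊓
    fAll (BoundedFormula.iff (fMem none (some (some v)))
      (fBEx (some none) (fSub (some none) none))))

variable {D : ZFSet.{u}} {I : P → ZFSet.{u}} {v : ι → Str D I}

/-- The set `h` is a history: each of its members is the union of the power sets, taken in `D`, of
the members of `h` that it contains. Recursion along the ordinals is thereby avoided. -/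
lemma realize_fLevel (hD : D.IsTransitive) {x : ι} :
    (fLevel (P := P) x).Realize v ↔ ∃ h ∈ D,
      (∀ w ∈ h, ∀ y ∈ D, y ∈ w ↔ ∃ z ∈ h, z ∈ w ∧ y ⊆ z) ∧
      ∀ y ∈ D, y ∈ (v x).val ↔ ∃ z ∈ h, y ⊆ z := by
  simp only [fLevel, Formula.realize_inf, realize_fEx, realize_fBAll, realize_fAll, realize_fIff,
    realize_fBEx, realize_fMem, realize_fSub hD, vcons_none, vcons_some]
  refine exists_congr fun h => ?_
  constructor
  · rintro ⟨hh, h1, h2⟩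
    refine ⟨hh, fun w hw y hy => ?_, fun y hy => ?_⟩
    · rw [h1 w (hD.subset_of_mem hh hw) hw y hy]
      exact ⟨fun ⟨z, _, h3, h4⟩ => ⟨z, h3, h4⟩,
        fun ⟨z, h3, h4⟩ => ⟨z, hD.subset_of_mem hh h3, h3, h4⟩⟩
    · rw [h2 y hy]
      exact ⟨fun ⟨z, _, h3, h4⟩ => ⟨z, h3, h4⟩,
        fun ⟨z, h3, h4⟩ => ⟨z, hD.subset_of_mem hh h3, h3, h4⟩⟩
  · rintro ⟨hh, h1, h2⟩
    refine ⟨hh, fun w _ hw y hy => ?_, fun y hy => ?_⟩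
    · rw [h1 w hw y hy]
      exact ⟨fun ⟨z, h3, h4⟩ => ⟨z, hD.subset_of_mem hh h3, h3, h4⟩,
        fun ⟨z, _, h3, h4⟩ => ⟨z, h3, h4⟩⟩
    · rw [h2 y hy]
      exact ⟨fun ⟨z, h3, h4⟩ => ⟨z, hD.subset_of_mem hh h3, h3, h4⟩,
        fun ⟨z, _, h3, h4⟩ => ⟨z, h3, h4⟩⟩

/-- If `rank y < rank x`, some `w ∈ x` has rank at least that of `y`. This `w` lies inside some `z`
of the form `V_β ∩ D` with `β ≥ rank y`, so `y ⊆ z` as well. -/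
lemma eq_vonNeumann_inter_of_forall_mem_iff (hD : D.IsTransitive) {x h : ZFSet.{u}}
    (hx : x ∈ D) {p : ZFSet.{u} → Prop}
    (hp : ∀ z ∈ h, p z → z = V_ (rank z) ∩ D)
    (H : ∀ y ∈ D, y ∈ x ↔ ∃ z ∈ h, p z ∧ y ⊆ z) : x = V_ (rank x) ∩ D := by
  ext y
  rw [ZFSet.mem_inter, mem_vonNeumann]
  refine ⟨fun hy => ⟨rank_lt_of_mem hy, hD.subset_of_mem hx hy⟩, ?_⟩
  rintro ⟨hy, hyD⟩
  obtain ⟨w, hw, hyw⟩ := lt_rank_iff.1 hy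
  obtain ⟨z, hz, hpz, hwz⟩ := (H w (hD.subset_of_mem hx hw)).1 hw
  refine (H y hyD).2 ⟨z, hz, hpz, ?_⟩
  rw [hp z hz hpz]
  intro t ht
  exact ZFSet.mem_inter.2 ⟨subset_vonNeumann.2 (hyw.trans (rank_mono hwz)) ht,
    hD.subset_of_mem hyD ht⟩

lemma eq_of_realize_fLevel (hD : D.IsTransitive) {x : ι}
    (h : (fLevel (P := P) x).Realize v) : (v x).val = V_ (rank (v x).val) ∩ D := by
  obtain ⟨h, hh, h1, h2⟩ := (realize_fLevel hD).1 h
  have key : ∀ z, z ∈ h → z = V_ (rank z) ∩ D := by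
    intro z
    induction z using ZFSet.inductionOn with
    | _ z ih =>
      intro hz
      exact eq_vonNeumann_inter_of_forall_mem_iff (h := h) (p := fun w => w ∈ z) hD
        (hD.subset_of_mem hh hz) (fun w hw hwz => ih w hwz hw) (h1 z hz)
  exact eq_vonNeumann_inter_of_forall_mem_iff (h := h) (p := fun _ => True) hD (v x).mem
    (fun z hz _ => key z hz) (by simpa using h2)

lemma realize_fLevel_vonNeumann {o a : Ordinal.{u}} (ha : a < o)
    {J : P → ZFSet.{u}} {w : ι → Str (V_ o) J} {x : ι} (hx : (w x).val = V_ a) :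
    (fLevel (P := P) x).Realize w := by
  rw [realize_fLevel (isTransitive_vonNeumann o)]
  -- The history of `V_a` consists of the earlier levels; its rank is at most `a`, so it lies in
  -- `V_o`.
  refine ⟨range (fun b : Set.Iio a => V_ b.1), ?_, ?_, ?_⟩
  · rw [mem_vonNeumann, rank_range]
    refine (Ordinal.iSup_le (a := a) fun b => ?_).trans_lt ha
    rw [rank_vonNeumann]
    exact Order.succ_le_of_lt b.2
  · intro z hz y _
    obtain ⟨b, rfl⟩ := mem_range.1 hz
    rw [mem_vonNeumann']
    constructor
    · rintro ⟨c, hc, h⟩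
      exact ⟨V_ c, mem_range.2 ⟨⟨c, hc.trans b.2⟩, rfl⟩, by simpa using hc, h⟩
    · rintro ⟨_, h1, h2, h3⟩
      obtain ⟨c, rfl⟩ := mem_range.1 h1
      exact ⟨c, by simpa using h2, h3⟩
  · intro y _
    rw [hx, mem_vonNeumann']
    constructor
    · rintro ⟨c, hc, h⟩
      exact ⟨V_ c, mem_range.2 ⟨⟨c, hc⟩, rfl⟩, h⟩
    · rintro ⟨_, h1, h3⟩
      obtain ⟨c, rfl⟩ := mem_range.1 h1
      exact ⟨c, c.2, h3⟩

end Levels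

/-! ### From extensions to reflection -/

section LevyHierarchy

variable {P : Type}

lemma IsDelta0.isSigma_and_isPi {m : ℕ} {φ : (setLang P).BoundedFormula Empty m}
    (h : IsDelta0 φ) (n : ℕ) : IsSigma n φ ∧ IsPi n φ := by
  induction n with
  | zero => exact ⟨.zero h, .zero h⟩
  | succ n ih => exact ⟨.ofPi ih.2, .ofSigma ih.1⟩

lemma isDelta0_of_isQF {m : ℕ} {φ : (setLang P).BoundedFormula Empty m} (h : φ.IsQF) :
    IsDelta0 φ := by
  induction h with
  | falsum => exact .falsum
  | of_isAtomic h =>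
    cases h with
    | equal s t => exact .equal s t
    | rel R ts => exact .rel R ts
  | imp _ _ h1 h2 => exact .imp h1 h2

lemma exists_isSigma_of_isPrenex {m : ℕ} {φ : (setLang P).BoundedFormula Empty m}
    (h : φ.IsPrenex) : ∃ n, IsSigma n φ := by
  induction h with
  | of_isQF h => exact ⟨0, .zero (isDelta0_of_isQF h)⟩
  | all _ ih =>
    obtain ⟨n, hn⟩ := ih
    exact ⟨n + 2, .ofPi (.all (.ofSigma hn))⟩
  | ex _ ih =>
    obtain ⟨n, hn⟩ := ih
    exact ⟨n + 2, .ex (.ofPi (.ofSigma hn))⟩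

end LevyHierarchy

/-- A fixed sentence has a prenex form, which is `Σₙ` for some `n`. The predicates agree on `V_κ`
because atomic formulas are `Σₙ`. -/
lemma HasExtensionProperty.exists_sentence {κ : Cardinal.{u}} (hκ : κ.IsInaccessible)
    (h : HasExtensionProperty κ) {A : ZFSet.{u}} (hA : IsDefinableSubset (V_ κ.ord) A)
    (θ : (setLang Unit).Sentence) (hθ : Str (V_ κ.ord) (fun _ : Unit => A) ⊨ θ) :
    ∃ X B : ZFSet.{u}, X.IsTransitive ∧ κ.ord.toZFSet ∈ X ∧ V_ κ.ord ⊆ X ∧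
      (∀ x ∈ V_ κ.ord, x ∈ A ↔ x ∈ B) ∧ Str X (fun _ : Unit => B) ⊨ θ := by
  obtain ⟨n, hn⟩ := exists_isSigma_of_isPrenex (BoundedFormula.toPrenex_isPrenex θ)
  obtain ⟨X, B, hX, -, hκX, hsub, hel⟩ := h n A hA
  refine ⟨X, B, hX, hκX, hsub, fun x hx => ?_, ?_⟩
  · have := hel 1 (Relations.boundedFormula₁ (L := setLang Unit) (SetRel.pred () : SetRel Unit 1)
      (Term.var (Sum.inr 0))) ((IsDelta0.rel _ _).isSigma_and_isPi n).1 (fun _ => ⟨x, hx⟩)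
    exact this
  · have h0 : (∅ : ZFSet.{u}) ∈ V_ κ.ord := by
      rw [mem_vonNeumann, rank_empty]
      exact (IsInaccessible.isSuccLimit_ord hκ).bot_lt
    -- Pulling quantifiers to the front is valid only in nonempty structures.
    have : Nonempty (Str (V_ κ.ord) (fun _ : Unit => A)) := ⟨⟨_, h0⟩⟩
    have : Nonempty (Str X (fun _ : Unit => B)) := ⟨⟨_, hsub h0⟩⟩
    have key := hel 0 _ hn Fin.elim0
    rw [BoundedFormula.realize_toPrenex, BoundedFormula.realize_toPrenex] at key
    have h2 := key.1 (by
      convert hθ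
      exact iff_of_eq (congrArg₂ _ (Subsingleton.elim _ _) (Subsingleton.elim _ _)))
    unfold Sentence.Realize Formula.Realize
    convert h2 using 2

-- Second-order satisfaction at a set, and the reflection argument

section Relativization

variable {k : ℕ}

/-- Restriction to the set which is the parameter `none`; the predicate `Sum.inr i` is given by
the parameter `some i`. -/
def relInterp (k : ℕ) : Interp (Unit ⊕ Fin k) Unit (Option (Fin k)) where
  dom q x := fMem x (q none)
  mem _ x y := fMem x y
  pred p q x := p.elim (fun _ => fPred () x) (fun i => fMem x (q (some i)))

lemma relInterp_interprets {D d A B : ZFSet.{u}} {Y : Fin k → ZFSet.{u}} (hd : d ⊆ D)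
    (hA : ∀ x ∈ d, x ∈ A ↔ x ∈ B) (q : Option (Fin k) → Str D (fun _ : Unit => B))
    (hq : (q none).val = d) (hY : ∀ i, (q (some i)).val = Y i) :
    (relInterp k).Interprets
      (fun x : Str d (Sum.elim (fun _ : Unit => A) Y) =>
        (⟨x.val, hd x.mem⟩ : Str D (fun _ : Unit => B))) q where
  inj x y h := Str.ext (congrArg (fun z => Str.val z) h :)
  dom v r x hr := by
    subst hr hq
    simp only [relInterp, realize_fMem]
    exact ⟨fun h => ⟨⟨_, h⟩, rfl⟩, by rintro ⟨a, ha⟩; rw [← ha]; exact a.mem⟩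
  mem v r x y a b hr ha hb := by
    simp only [relInterp, realize_fMem, ← ha, ← hb]
    exact Iff.rfl
  pred p v r x a hr ha := by
    subst hr
    rcases p with ⟨⟩ | i
    · simp only [relInterp, Sum.elim_inl, realize_fPred, ← ha]
      exact (hA _ a.mem).symm
    · simp only [relInterp, Sum.elim_inr, realize_fMem, ← ha]
      change _ ∈ ((v ∘ r) (some i)).val ↔ _
      rw [hY]
      exact Iff.rfl

/-- The formula `x ⊨ ∀ Y φ`, for the set `x`. -/
noncomputable def fSatPi11 (φ : (setLang (Unit ⊕ Fin k)).Sentence) {ι : Type} (x : ι) :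
    (setLang Unit).Formula ι :=
  Formula.iAlls (Fin k) (BoundedFormula.imp
    (Formula.iInf fun i : Fin k => (fSub (Sum.inr i) (Sum.inl x) : (setLang Unit).Formula _))
    ((relInterp k).tr φ (fun o => o.elim (Sum.inl x) Sum.inr) Fin.elim0))

/-- The second-order variables range only over subsets of the set that belong to `D`. For a set in
`V_κ` these are all its subsets; in an extension they may be fewer, which is harmless for a `Π¹₁`
sentence known to be true. -/
lemma realize_fSatPi11 {φ : (setLang (Unit ⊕ Fin k)).Sentence} {ι : Type} {x : ι}
    {D A B : ZFSet.{u}} (hD : D.IsTransitive) {v : ι → Str D (fun _ : Unit => B)}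
    (hA : ∀ y ∈ (v x).val, y ∈ A ↔ y ∈ B) :
    (fSatPi11 φ x).Realize v ↔ ∀ Y : Fin k → ZFSet.{u}, (∀ i, Y i ∈ D) →
      (∀ i, Y i ⊆ (v x).val) → Str (v x).val (Sum.elim (fun _ : Unit => A) Y) ⊨ φ := by
  have key : ∀ Y : Fin k → Str D (fun _ : Unit => B),
      ((relInterp k).tr φ (fun o => o.elim (Sum.inl x) Sum.inr) Fin.elim0).Realize (Sum.elim v Y) ↔
        Str (v x).val (Sum.elim (fun _ : Unit => A) (fun i => (Y i).val)) ⊨ φ := by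
    intro Y
    exact (relInterp_interprets (hD.subset_of_mem (v x).mem) hA
      (fun o => o.elim (v x) Y) rfl (fun i => rfl)).realize_tr φ _ _ _ default default
      (by funext o; cases o <;> rfl) (fun i => i.elim0)
  simp only [fSatPi11, Formula.realize_iAlls, realize_fImp, Formula.realize_iInf,
    realize_fSub hD]
  constructor
  · intro H Y hYD hY
    exact (key fun i => ⟨Y i, hYD i⟩).1 (H _ hY)
  · intro H Y hY
    exact (key Y).2 (H _ (fun i => (Y i).mem) hY)

end Relativization

/-- The sentence expressing that every ordinal is the set of ordinals of some level. -/
def levelSentence : (setLang Unit).Sentence :=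
  fAll ((fOrd none).imp (fEx (fLevel none ⊓
    fAll ((fMem none (some none) ⊓ fOrd none).iff (fMem none (some (some none)))))))

lemma realize_levelSentence {D : ZFSet.{u}} (hD : D.IsTransitive) {I : Unit → ZFSet.{u}} :
    Str D I ⊨ levelSentence ↔ ∀ b ∈ D, b.IsOrdinal → ∃ x, ∃ hx : x ∈ D,
      (fLevel (P := Unit) ()).Realize (fun _ : Unit => (⟨x, hx⟩ : Str D I)) ∧
      ∀ y ∈ D, y ∈ x ∧ y.IsOrdinal ↔ y ∈ b := by
  simp only [Sentence.Realize, levelSentence, realize_fAll, realize_fImp, realize_fOrd hD,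
    realize_fEx, Formula.realize_inf, realize_fIff, realize_fMem, realize_fLevel hD,
    vcons_none, vcons_some]

theorem isPi11Reflecting_of_hasExtensionProperty {κ : Cardinal.{u}} (hκ : κ.IsInaccessible)
    (h : HasExtensionProperty κ) : IsPi11Reflecting κ := by
  refine ⟨hκ, fun A hA k φ hφ => ?_⟩
  have hlim := IsInaccessible.isSuccLimit_ord hκ
  have hV := isTransitive_vonNeumann κ.ord
  by_contra hcon
  push Not at hcon
  let τ : (setLang Unit).Sentence := fEx (fLevel none ⊓ fSatPi11 φ none)
  have h1 : Str (V_ κ.ord) (fun _ : Unit => A) ⊨ levelSentence ⊓ ∼ τ := by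
    rw [Sentence.Realize, Formula.realize_inf, Formula.realize_not]
    constructor
    · refine (realize_levelSentence hV).2 fun b hb hbo => ?_
      have hb' := mem_vonNeumann.1 hb
      refine ⟨V_ (rank b), by simpa using hb', realize_fLevel_vonNeumann hb' rfl,
        fun y _ => ?_⟩
      constructor
      · rintro ⟨h1, h2⟩
        exact (h2.rank_lt_iff_mem hbo).1 (mem_vonNeumann.1 h1)
      · exact fun h1 => ⟨mem_vonNeumann.2 (rank_lt_of_mem h1), hbo.mem h1⟩
    · simp only [τ, realize_fEx, Formula.realize_inf, not_exists, not_and]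
      intro x hx hl hs
      have hxV := eq_of_realize_fLevel hV hl
      simp only [vcons_none] at hxV
      have hx' := mem_vonNeumann.1 hx
      rw [ZFSet.inter_eq_left_of_subset (vonNeumann_subset_of_le hx'.le)] at hxV
      refine hcon _ hx' fun Y hY => ?_
      -- Subsets of `V_ (rank x)` have rank at most `rank x < κ`, so restricting to those in `V_κ`
      -- loses nothing.
      have := (realize_fSatPi11 (A := A ∩ V_ (rank x)) hV (by
        intro y hy
        rw [vcons_none] at hy
        change y ∈ x at hy
        rw [hxV] at hy
        simp [hy])).1 hs Y (fun i => mem_vonNeumann.2 (by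
          have := subset_vonNeumann.1 (hY i)
          exact this.trans_lt hx'))
      simp only [vcons_none] at this
      rw [← hxV] at this ⊢
      exact this (by rwa [hxV])
  obtain ⟨X, B, hX, hκX, hsub, hAB, h2⟩ := h.exists_sentence hκ hA _ h1
  rw [Sentence.Realize, Formula.realize_inf, Formula.realize_not] at h2
  obtain ⟨h3, h4⟩ := h2
  apply h4
  obtain ⟨x, hx, hl, hxo⟩ := (realize_levelSentence hX).1 h3 _ hκX (isOrdinal_toZFSet _)
  have hxV := eq_of_realize_fLevel hX hl
  simp only at hxV
  -- The level `x` given by `levelSentence` for the ordinal `κ` has exactly the ordinals below `κ`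
  -- as elements. Since `κ` and all smaller ordinals are in `X`, this forces `rank x = κ`.
  have hord : ∀ a : Ordinal.{u}, a.toZFSet ∈ X → (a < rank x ↔ a < κ.ord) := by
    intro a ha
    have := hxo _ ha
    rw [hxV, ZFSet.mem_inter, toZFSet_mem_vonNeumann, Ordinal.toZFSet_mem_toZFSet_iff] at this
    simpa [ha, isOrdinal_toZFSet] using this
  have hrank : rank x = κ.ord := by
    apply le_antisymm
    · exact not_lt.1 fun hlt => lt_irrefl _ ((hord _ hκX).1 hlt)
    · refine le_of_forall_lt fun a ha => (hord a ?_).2 ha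
      exact hsub (toZFSet_mem_vonNeumann.2 ha)
  rw [hrank, ZFSet.inter_eq_left_of_subset hsub] at hxV
  subst hxV
  simp only [τ, realize_fEx, Formula.realize_inf]
  refine ⟨_, hx, ?_, ?_⟩
  · rw [realize_fLevel hX] at hl ⊢
    exact hl
  · exact (realize_fSatPi11 hX hAB).2 fun Y _ hY => hφ Y hY

/-! ### Definability -/

section Definability

variable {P : Type} {D : ZFSet.{u}} {I : P → ZFSet.{u}}

/-- The variable which is the given term. -/
def termVar {β : Type*} : (setLang P).Term β → β
  | Term.var b => b
  | Term.func f _ => Empty.elim f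

lemma var_termVar {β : Type*} (t : (setLang P).Term β) : t = Term.var (termVar t) := by
  match t with
  | Term.var b => rfl
  | Term.func f _ => exact Empty.elim f

/-- The identity map from `(D, ∈)` to `(D, ∈, I)`. -/
def expand (I : P → ZFSet.{u}) (x : Str D (Empty.elim : Empty → ZFSet.{u})) : Str D I :=
  ⟨x.val, x.mem⟩

/-- Predicates definable over `(D, ∈)` create no new definable sets: an atom `p(x)` is replaced by
the definition of `p`, whose parameters are allowed. -/
lemma definable_realize_boundedFormula (hI : ∀ p, IsDefinableSubset D (I p)) {α : Type} {m : ℕ}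
    (ψ : (setLang P).BoundedFormula α m) :
    (Set.univ : Set (Str D (Empty.elim : Empty → ZFSet.{u}))).Definable (setLang Empty)
      {w : α ⊕ Fin m → Str D (Empty.elim : Empty → ZFSet.{u}) |
        ψ.Realize (fun a => expand I (w (.inl a))) (fun i => expand I (w (.inr i)))} := by
  have hterm : ∀ {m : ℕ} (t : (setLang P).Term (α ⊕ Fin m))
      (w : α ⊕ Fin m → Str D (Empty.elim : Empty → ZFSet.{u})),
      t.realize (Sum.elim (fun a => expand I (w (.inl a))) (fun i => expand I (w (.inr i)))) =
        expand I (w (termVar t)) := by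
    intro m t w
    conv_lhs => rw [var_termVar t]
    rw [Term.realize_var]
    cases termVar t <;> rfl
  have hformula : ∀ {m : ℕ} (χ : (setLang Empty).Formula (α ⊕ Fin m)),
      (Set.univ : Set (Str D (Empty.elim : Empty → ZFSet.{u}))).Definable (setLang Empty)
        {w | χ.Realize w} := fun χ =>
    (Set.empty_definable_iff.2 ⟨χ, rfl⟩).mono (Set.empty_subset _)
  induction ψ with
  | falsum => exact Set.definable_empty
  | equal s t =>
    convert hformula (fEq (termVar s) (termVar t)) using 1
    ext w
    simp only [BoundedFormula.Realize, hterm, Set.mem_ofPred_eq, realize_fEq]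
    exact Str.ext_iff
  | @rel n l R ts =>
    simp only [BoundedFormula.Realize, hterm]
    cases R with
    | mem =>
      convert hformula (fMem (termVar (ts 0)) (termVar (ts 1))) using 1
      ext w
      simp only [Set.mem_ofPred_eq, realize_fMem]
      exact Iff.rfl
    | pred p =>
      exact (hI p).2.preimage_comp (fun _ : Fin 1 => termVar (ts 0))
  | imp φ ψ ih1 ih2 =>
    convert ih1.compl.union ih2 using 1
    ext w
    simp only [BoundedFormula.realize_imp, Set.mem_ofPred_eq, Set.mem_union, Set.mem_compl_iff]
    tauto
  | @all n φ ih =>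
    -- The last variable is moved to a separate coordinate indexed by `Unit`, over which definable
    -- sets can be quantified.
    have h1 := (ih.preimage_comp (fun a : α ⊕ Fin (n + 1) => (a.elim (fun a => .inl (.inl a))
      (Fin.snoc (α := fun _ => (α ⊕ Fin n) ⊕ Unit) (fun i => .inl (.inr i)) (.inr ())) :
        (α ⊕ Fin n) ⊕ Unit))).forall_of_finite
    convert h1 using 1
    ext w
    simp only [BoundedFormula.realize_all, Set.mem_ofPred_eq]
    have key : ∀ x : Str D (Empty.elim : Empty → ZFSet.{u}),
        (Fin.snoc (fun i => expand I (w (.inr i))) (expand I x) : Fin (n + 1) → Str D I) =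
        fun i => expand I (Sum.elim w (fun _ : Unit => x) (Fin.snoc
          (α := fun _ => (α ⊕ Fin n) ⊕ Unit) (fun i => .inl (.inr i)) (.inr ()) i)) := by
      intro x
      funext i
      refine Fin.lastCases ?_ (fun i => ?_) i <;> simp
    constructor
    · intro H u
      have := H (expand I (u ()))
      rw [key] at this
      exact this
    · intro H x
      have := H (fun _ => ⟨x.val, x.mem⟩)
      have h2 := key ⟨x.val, x.mem⟩
      change Fin.snoc (α := fun _ => Str D I) _ x = _ at h2
      rw [h2]
      exact this

lemma isDefinableSubset_of_formula (hI : ∀ p, IsDefinableSubset D (I p)) {ι : Type} [Finite ι]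
    (ψ : (setLang P).Formula (Option ι)) (q : ι → Str D I) {A : ZFSet.{u}} (hA : A ⊆ D)
    (h : ∀ x (hx : x ∈ D), x ∈ A ↔ ψ.Realize (vcons ⟨x, hx⟩ q)) : IsDefinableSubset D A := by
  refine ⟨hA, ?_⟩
  have h1 := definable_realize_boundedFormula hI ψ
  let F : (Fin 1 → Str D (Empty.elim : Empty → ZFSet.{u})) →
      (Option ι ⊕ Fin 0 → Str D (Empty.elim : Empty → ZFSet.{u})) :=
    fun x => Sum.elim (vcons (x 0) fun i => ⟨(q i).val, (q i).mem⟩) Fin.elim0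
  have hF : (Set.univ : Set (Str D (Empty.elim : Empty → ZFSet.{u}))).DefinableMap
      (setLang Empty) F := by
    rintro ((_ | i) | i)
    · exact Set.DefinableFun.proj (setLang Empty)
    · exact definableFun_const (setLang Empty) _ (Set.mem_univ _)
    · exact i.elim0
  have h2 := Set.Definable.preimage_map hF h1
  unfold Set.Definable₁
  convert h2 using 1
  ext x
  simp only [Set.mem_ofPred_eq, Set.mem_preimage]
  rw [h _ (x 0).mem, Formula.Realize]
  refine iff_of_eq (congrArg₂ _ ?_ (Subsingleton.elim _ _))
  funext o
  cases o <;> rfl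

end Definability

/-! ### Numerals and tags -/

section Numerals

variable {P ι : Type}

/-- The numeral `n` as a set. -/
noncomputable def num (n : ℕ) : ZFSet.{u} := (n : Ordinal.{u}).toZFSet

lemma num_inj {m n : ℕ} : (num m : ZFSet.{u}) = num n ↔ m = n := by
  rw [num, num, Ordinal.toZFSet_injective.eq_iff, Nat.cast_inj]

lemma num_mem_num {m n : ℕ} : (num m : ZFSet.{u}) ∈ num n ↔ m < n := by
  rw [num, num, Ordinal.toZFSet_mem_toZFSet_iff, Nat.cast_lt]

lemma mem_num {x : ZFSet.{u}} {n : ℕ} : x ∈ num n ↔ ∃ m < n, x = num m := by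
  rw [num, Ordinal.mem_toZFSet_iff]
  constructor
  · rintro ⟨a, ha, rfl⟩
    obtain ⟨m, rfl⟩ := Ordinal.lt_omega0.1 (ha.trans (Ordinal.natCast_lt_omega0 n))
    exact ⟨m, by exact_mod_cast ha, rfl⟩
  · rintro ⟨m, hm, rfl⟩
    exact ⟨m, by exact_mod_cast hm, rfl⟩

lemma num_succ (n : ℕ) : (num (n + 1) : ZFSet.{u}) = insert (num n) (num n) := by
  rw [num, num, Nat.cast_add, Nat.cast_one, Ordinal.toZFSet_add_one]

lemma num_mem_vonNeumann {o : Ordinal.{u}} (ho : Order.IsSuccLimit o) (n : ℕ) :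
    num n ∈ V_ o :=
  toZFSet_mem_vonNeumann.2 ((Ordinal.natCast_lt_omega0 n).trans_le
    (Ordinal.omega0_le_of_isSuccLimit ho))

/-- The formula expressing that `x` is the numeral `n`. -/
def fNum : ℕ → ∀ {ι : Type}, ι → (setLang P).Formula ι
  | 0, _, x => fBAll x ⊥
  | n + 1, _, x => fBEx x (fNum n none ⊓ (fSub none (some x) ⊓
      fBAll (some x) (fEq none (some none) ⊔ fMem none (some none))))

variable {D : ZFSet.{u}} {I : P → ZFSet.{u}}

lemma realize_fNum (hD : D.IsTransitive) {n : ℕ} {ι : Type} {v : ι → Str D I} {x : ι} :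
    (fNum (P := P) n x).Realize v ↔ (v x).val = num n := by
  induction n generalizing ι with
  | zero =>
    simp only [fNum, realize_fBAll, Formula.realize_bot, num, Nat.cast_zero,
      Ordinal.toZFSet_zero, ZFSet.eq_empty]
    exact ⟨fun h y hy => h y (hD.subset_of_mem (v x).mem hy) hy, fun h y _ hy => h y hy⟩
  | succ n ih =>
    simp only [fNum, realize_fBEx, Formula.realize_inf, ih, realize_fSub hD, realize_fBAll,
      Formula.realize_sup, realize_fEq, realize_fMem, vcons_none, vcons_some, num_succ]
    constructor
    · rintro ⟨w, _, hw, rfl, h1, h2⟩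
      ext y
      rw [ZFSet.mem_insert_iff]
      refine ⟨fun hy => h2 y (hD.subset_of_mem (v x).mem hy) hy, ?_⟩
      rintro (rfl | hy)
      exacts [hw, h1 hy]
    · intro h
      have h1 : num n ∈ (v x).val := by rw [h]; simp
      refine ⟨num n, hD.subset_of_mem (v x).mem h1, h1, rfl, ?_, ?_⟩
      · rw [h]
        exact fun y hy => ZFSet.mem_insert_of_mem _ hy
      · intro y _ hy
        rwa [h, ZFSet.mem_insert_iff] at hy

/-- The formula `p((n, x))`, for the numeral `n`. -/
def fTag (p : P) (n : ℕ) (x : ι) : (setLang P).Formula ι :=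
  fEx (fNum n none ⊓ fPairPred p none (some x))

lemma realize_fTag (hD : D.IsTransitive) {v : ι → Str D I} {p : P} {n : ℕ} {x : ι} :
    (fTag p n x).Realize v ↔ pair (num n) (v x).val ∈ D ∧ pair (num n) (v x).val ∈ I p := by
  simp only [fTag, realize_fEx, Formula.realize_inf, realize_fNum hD, realize_fPairPred hD,
    vcons_none, vcons_some]
  exact ⟨by rintro ⟨_, _, rfl, h⟩; exact h,
    fun h => ⟨_, mem_of_pair_mem_left hD h.1, rfl, h⟩⟩

/-- The disjoint union of the subsets `I q` of `D`. -/
noncomputable def tagged {r : ℕ} (D : ZFSet.{u}) (I : Fin r → ZFSet.{u}) : ZFSet.{u} :=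
  ZFSet.sep (fun z => ∃ q : Fin r, ∃ x ∈ I q, z = pair (num q) x) D

lemma pair_mem_tagged {r : ℕ} {D : ZFSet.{u}} {I : Fin r → ZFSet.{u}} {q : Fin r}
    {x : ZFSet.{u}} : pair (num q) x ∈ tagged D I ↔ pair (num q) x ∈ D ∧ x ∈ I q := by
  rw [tagged, ZFSet.mem_sep]
  refine and_congr_right fun _ => ⟨?_, fun h => ⟨q, x, h, rfl⟩⟩
  rintro ⟨q', x', h, h'⟩
  rw [pair_inj, num_inj] at h'
  obtain ⟨h1, rfl⟩ := h'
  rwa [Fin.ext h1]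

/-- Reflection is available for one predicate only; tagging by numerals packs finitely many
definable predicates into one that is still definable. -/
lemma isDefinableSubset_tagged {r : ℕ} {D : ZFSet.{u}} (hD : D.IsTransitive)
    {I : Fin r → ZFSet.{u}}
    (hI : ∀ p, IsDefinableSubset D (I p)) : IsDefinableSubset D (tagged D I) := by
  refine isDefinableSubset_of_formula (ι := Empty) hI
    (Formula.iSup fun q : Fin r => (fEx (fPred q none ⊓ fEx (fNum q none ⊓
      fPair none (some none) (some (some none)))) : (setLang (Fin r)).Formula (Option Empty)))
    Empty.elim ZFSet.sep_subset fun x hx => ?_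
  simp only [tagged, ZFSet.mem_sep, hx, true_and, Formula.realize_iSup, realize_fEx,
    Formula.realize_inf, realize_fPred, realize_fNum hD, realize_fPair hD, vcons_none, vcons_some]
  refine exists_congr fun q => ⟨?_, ?_⟩
  · rintro ⟨y, hy, rfl⟩
    exact ⟨y, mem_of_pair_mem_right hD hx, hy, _, mem_of_pair_mem_left hD hx, rfl, rfl⟩
  · rintro ⟨y, _, hy, _, _, rfl, h⟩
    exact ⟨y, hy, h⟩

end Numerals

/-! ### The transitive collapse -/

section Collapse

variable {α : Type*} [Small.{u} α] {R : α → α → Prop} (hR : WellFounded R)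

/-- The Mostowski collapse of a well-founded relation. -/
noncomputable def collapse : α → ZFSet.{u} :=
  hR.fix fun x ih => range fun y : {y // R y x} => ih y.1 y.2

lemma mem_collapse {x : α} {z : ZFSet.{u}} :
    z ∈ collapse hR x ↔ ∃ y, R y x ∧ collapse hR y = z := by
  rw [collapse, hR.fix_eq, mem_range]
  simp

lemma collapse_injective (hext : ∀ x y, (∀ z, R z x ↔ R z y) → x = y) :
    Function.Injective (collapse (hR := hR)) := by
  intro x
  induction x using hR.induction with
  | _ x ih =>
    intro y hxy
    refine hext x y fun z => ⟨fun hz => ?_, fun hz => ?_⟩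
    · obtain ⟨w, hw, h⟩ := (mem_collapse hR).1 (hxy ▸ (mem_collapse hR).2 ⟨z, hz, rfl⟩)
      rwa [ih z hz h.symm]
    · obtain ⟨w, hw, h⟩ := (mem_collapse hR).1 (hxy ▸ (mem_collapse hR).2 ⟨z, hz, rfl⟩)
      rwa [← ih w hw h]

lemma collapse_mem_collapse (hext : ∀ x y, (∀ z, R z x ↔ R z y) → x = y) {x y : α} :
    collapse hR x ∈ collapse hR y ↔ R x y := by
  rw [mem_collapse]
  constructor
  · rintro ⟨z, hz, h⟩
    rwa [← collapse_injective hR hext h]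
  · exact fun h => ⟨x, h, rfl⟩

lemma isTransitive_range_collapse : (range (collapse hR)).IsTransitive := by
  intro y hy z hz
  obtain ⟨x, rfl⟩ := mem_range.1 hy
  obtain ⟨w, -, rfl⟩ := (mem_collapse hR).1 hz
  exact mem_range_self w

end Collapse

/-! ### Extensions coded by subsets of the domain -/

section Codes

variable {r : ℕ}

/-- `E` is a well-founded extensional relation on `D`, and `J` embeds `(D, ∈, I)` for the family
`I` coded by `A` onto an initial segment of `(D, E, B)` which is not closed under the formation of
the supremum of the ordinals. -/
structure IsCode (D A E J : ZFSet.{u}) (B : Fin r → ZFSet.{u}) : Prop where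
  wf : ∀ b ∈ D, (∃ x ∈ D, x ∈ b) → ∃ x ∈ D, x ∈ b ∧ ∀ y ∈ D, y ∈ b → pair y x ∉ E
  ext : ∀ x ∈ D, ∀ y ∈ D, (∀ z ∈ D, pair z x ∈ E ↔ pair z y ∈ E) → x = y
  total : ∀ x ∈ D, ∃ y ∈ D, pair x y ∈ J
  initial : ∀ x ∈ D, ∀ y ∈ D, pair x y ∈ J →
    ∀ z ∈ D, pair z y ∈ E ↔ ∃ w ∈ D, w ∈ x ∧ pair w z ∈ J
  top : ∃ c ∈ D, ∀ z ∈ D, pair z c ∈ E ↔ ∃ w ∈ D, w.IsOrdinal ∧ pair w z ∈ J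
  pred : ∀ x ∈ D, ∀ y ∈ D, pair x y ∈ J →
    ∀ q : Fin r, pair (num q) x ∈ D ∧ pair (num q) x ∈ A ↔ y ∈ B q

/-- The second-order variables coding an extension. -/
def codeVars (E J : ZFSet.{u}) (B : Fin r → ZFSet.{u}) : Fin (r + 2) → ZFSet.{u} :=
  Fin.cons E (Fin.cons J B)

/-- The sentence expressing `IsCode`. -/
noncomputable def codeSentence (r : ℕ) : (setLang (Unit ⊕ Fin (r + 2))).Sentence :=
  fAll ((fEx (fMem none (some none))).imp (fBEx none
    (fBAll (some none) (∼ (fPairPred (.inr 0) none (some none)))))) ⊓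
  (fAll (fAll ((fAll (BoundedFormula.iff (fPairPred (.inr 0) none (some (some none)))
    (fPairPred (.inr 0) none (some none)))).imp (fEq (some none) none))) ⊓
  (fAll (fEx (fPairPred (.inr 1) (some none) none)) ⊓
  (fAll (fAll ((fPairPred (.inr 1) (some none) none).imp (fAll (BoundedFormula.iff
    (fPairPred (.inr 0) none (some none))
    (fBEx (some (some none)) (fPairPred (.inr 1) none (some none))))))) ⊓
  (fEx (fAll (BoundedFormula.iff (fPairPred (.inr 0) none (some none))
    (fEx (fOrd none ⊓ fPairPred (.inr 1) none (some none))))) ⊓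
  fAll (fAll ((fPairPred (.inr 1) (some none) none).imp (Formula.iInf fun q : Fin r =>
    (BoundedFormula.iff (fTag (.inl ()) q (some none)) (fPred (.inr q.succ.succ) none) :
      (setLang (Unit ⊕ Fin (r + 2))).Formula _))))))))

/-- The point is that every clause is first-order in `E`, `J`, `B`. Well-foundedness is tested only
on elements of `D`, not on all its subsets; otherwise the nonexistence of a code would not be `Π¹₁`.
-/
lemma realize_codeSentence {D A E J : ZFSet.{u}} {B : Fin r → ZFSet.{u}} (hD : D.IsTransitive)
    (hE : E ⊆ D) (hJ : J ⊆ D) :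
    Str D (Sum.elim (fun _ : Unit => A) (codeVars E J B)) ⊨ codeSentence r ↔
      IsCode D A E J B := by
  have h0 : codeVars E J B 0 = E := rfl
  have h1 : codeVars E J B 1 = J := rfl
  have h2 : ∀ q : Fin r, codeVars E J B q.succ.succ = B q := fun _ => rfl
  have hE' : ∀ x y : ZFSet.{u}, pair x y ∈ D ∧ pair x y ∈ E ↔ pair x y ∈ E :=
    fun x y => and_iff_right_of_imp fun h => hE h
  have hJ' : ∀ x y : ZFSet.{u}, pair x y ∈ D ∧ pair x y ∈ J ↔ pair x y ∈ J :=
    fun x y => and_iff_right_of_imp fun h => hJ h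
  simp only [Sentence.Realize, codeSentence, Formula.realize_inf, realize_fAll, realize_fImp,
    realize_fEx, realize_fMem, realize_fBEx, realize_fBAll, Formula.realize_not,
    realize_fPairPred hD, realize_fIff, realize_fEq, realize_fOrd hD, realize_fTag hD,
    realize_fPred, Formula.realize_iInf, vcons_none, vcons_some, Sum.elim_inr, Sum.elim_inl,
    h0, h1, h2, hE', hJ', exists_prop]
  exact ⟨fun ⟨h1, h2, h3, h4, h5, h6⟩ => ⟨h1, h2, h3, h4, h5, h6⟩,
    fun ⟨h1, h2, h3, h4, h5, h6⟩ => ⟨h1, h2, h3, h4, h5, h6⟩⟩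

/-- The structure `(D, E, B)` coded by the second-order variables. -/
def codeInterp (r : ℕ) : Interp (Fin r) (Unit ⊕ Fin (r + 2)) Empty where
  dom _ _ := ⊤
  mem _ x y := fPairPred (.inr 0) x y
  pred q _ x := fPred (.inr q.succ.succ) x

lemma codeInterp_interprets {D A E J : ZFSet.{u}} {B : Fin r → ZFSet.{u}} (hD : D.IsTransitive)
    (hE : E ⊆ D) {M : Type*} [(setLang (Fin r)).Structure M]
    (e : M → Str D (Sum.elim (fun _ : Unit => A) (codeVars E J B)))
    (he : Function.Bijective e)
    (hmem : ∀ a b, Structure.RelMap (L := setLang (Fin r)) (SetRel.mem : SetRel (Fin r) 2) ![a, b]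
      ↔ pair (e a).val (e b).val ∈ E)
    (hpred : ∀ q a, Structure.RelMap (L := setLang (Fin r)) (SetRel.pred q : SetRel (Fin r) 1) ![a]
      ↔ (e a).val ∈ B q) :
    (codeInterp r).Interprets e Empty.elim where
  inj := he.1
  dom v _ x _ := by
    simp only [codeInterp, Formula.realize_top, true_iff]
    exact he.2 (v x)
  mem v _ x y a b _ ha hb := by
    simp only [codeInterp, realize_fPairPred hD, ← ha, ← hb, hmem]
    exact and_iff_right_of_imp fun h => hE h
  pred q v _ x a _ ha := by
    simp only [codeInterp, realize_fPred, ← ha, hpred]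
    rfl

/-- The sentence expressing that the domain is nonempty and closed under pairs. -/
def pairSentence {P : Type} : (setLang P).Sentence :=
  fEx (fEq none none) ⊓ fAll (fAll (fEx (fPair (some (some none)) (some none) none)))

lemma realize_pairSentence {P : Type} {D : ZFSet.{u}} {I : P → ZFSet.{u}} (hD : D.IsTransitive) :
    Str D I ⊨ (pairSentence : (setLang P).Sentence) ↔ (∃ x, x ∈ D) ∧ ∀ x ∈ D, ∀ y ∈ D, pair x y ∈ D := by
  simp only [Sentence.Realize, pairSentence, Formula.realize_inf, realize_fAll, realize_fEx,
    realize_fEq, realize_fPair hD, vcons_none, vcons_some, exists_prop, and_true]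
  refine and_congr_right fun _ => ?_
  refine forall₂_congr fun x _ => forall₂_congr fun y _ => ?_
  exact ⟨by rintro ⟨z, hz, rfl⟩; exact hz, fun h => ⟨_, h, rfl⟩⟩

/-- The sentence `χ` such that `∀ Y χ` expresses that there is no code of an extension satisfying
`φ`. -/
noncomputable def noCodeSentence (φ : (setLang (Fin r)).Sentence) :
    (setLang (Unit ⊕ Fin (r + 2))).Sentence :=
  pairSentence ⊓ ∼ (codeSentence r ⊓ (codeInterp r).tr φ Empty.elim Fin.elim0)

end Codes

-- Extensions from codes, and codes from elementary substructures

instance {P : Type} {D : ZFSet.{u}} {I : P → ZFSet.{u}} : Small.{u} (Str D I) :=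
  small_of_injective (β := D) (f := fun x => ⟨x.val, x.mem⟩) fun _ _ h =>
    Str.ext (congrArg Subtype.val h)

/-- The extension is the transitive collapse of `E`. The collapse inverts `J`, so it covers `V_κ`,
and the point given by `IsCode.top` collapses to `κ`. -/
lemma exists_extension_of_isCode {r : ℕ} {κ : Cardinal.{u}} (hκ : κ.IsInaccessible)
    {I : Fin r → ZFSet.{u}} {E J : ZFSet.{u}} {B : Fin r → ZFSet.{u}}
    (hE : E ⊆ V_ κ.ord) (hc : IsCode (V_ κ.ord) (tagged (V_ κ.ord) I) E J B)
    (φ : (setLang (Fin r)).Sentence)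
    (hφ : Str (V_ κ.ord) (Sum.elim (fun _ : Unit => tagged (V_ κ.ord) I) (codeVars E J B)) ⊨
      ((codeInterp r).tr φ Empty.elim Fin.elim0 : (setLang (Unit ⊕ Fin (r + 2))).Formula Empty)) :
    ∃ (X : ZFSet.{u}) (I' : Fin r → ZFSet.{u}), X.IsTransitive ∧ (∀ q, I' q ⊆ X) ∧
      κ.ord.toZFSet ∈ X ∧ V_ κ.ord ⊆ X ∧ (∀ q, ∀ x ∈ V_ κ.ord, x ∈ I' q ↔ x ∈ I q) ∧
      Str X I' ⊨ φ := by
  have hlim := IsInaccessible.isSuccLimit_ord hκ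
  have hV := isTransitive_vonNeumann κ.ord
  let N := Str (V_ κ.ord) (Sum.elim (fun _ : Unit => tagged (V_ κ.ord) I) (codeVars E J B))
  let R : N → N → Prop := fun a b => pair a.val b.val ∈ E
  have hR : WellFounded R := by
    rw [wellFounded_iff_isEmpty_descending_chain]
    refine ⟨fun ⟨f, hf⟩ => ?_⟩
    -- The range of a descending chain is a countable subset of `V_κ`, hence an element, and the
    -- clause `wf` applies to it.
    obtain ⟨x, -, hx, hmin⟩ := hc.wf (range fun n => (f n).val)
      (range_mem_vonNeumann hκ fun n => (f n).mem) ⟨(f 0).val, (f 0).mem, mem_range_self 0⟩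
    obtain ⟨n, rfl⟩ := mem_range.1 hx
    exact hmin (f (n + 1)).val (f (n + 1)).mem (mem_range.2 ⟨n + 1, rfl⟩) (hf n)
  have hext : ∀ x y : N, (∀ z, R z x ↔ R z y) → x = y := fun x y h =>
    Str.ext (hc.ext _ x.mem _ y.mem fun z hz => h ⟨z, hz⟩)
  let c := collapse hR
  have hcinj : Function.Injective c := collapse_injective hR hext
  -- By `∈`-induction on `x`: the `E`-predecessors of `y` are `J`-images of elements of `x`, which
  -- collapse to those elements.
  have hJ : ∀ x ∈ V_ κ.ord, ∀ y : N, pair x y.val ∈ J → c y = x := by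
    intro x
    induction x using ZFSet.inductionOn with
    | _ x ih =>
      intro hx y hy
      ext z
      rw [mem_collapse]
      constructor
      · rintro ⟨w, hw, rfl⟩
        obtain ⟨t, ht, htx, htw⟩ := (hc.initial x hx _ y.mem hy _ w.mem).1 hw
        rwa [show collapse hR w = t from ih t htx ht w htw]
      · intro hz
        have hzV := hV.subset_of_mem hx hz
        obtain ⟨w, hw, hzw⟩ := hc.total z hzV
        exact ⟨⟨w, hw⟩, (hc.initial x hx _ y.mem hy w hw).2 ⟨z, hzV, hz, hzw⟩,
          ih z hz hzV ⟨w, hw⟩ hzw⟩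
  have hsub : V_ κ.ord ⊆ range c := by
    intro x hx
    obtain ⟨y, hy, hxy⟩ := hc.total x hx
    exact mem_range.2 ⟨⟨y, hy⟩, hJ x hx ⟨y, hy⟩ hxy⟩
  refine ⟨range c, fun q => (range c).sep fun z => ∃ y : N, c y = z ∧ y.val ∈ B q,
    isTransitive_range_collapse hR, fun q => ZFSet.sep_subset, ?_, hsub, ?_, ?_⟩
  · obtain ⟨t, ht, htop⟩ := hc.top
    refine mem_range.2 ⟨⟨t, ht⟩, ?_⟩
    ext z
    rw [mem_collapse, Ordinal.mem_toZFSet_iff]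
    constructor
    · rintro ⟨w, hw, rfl⟩
      obtain ⟨a, ha, hao, haw⟩ := (htop _ w.mem).1 hw
      refine ⟨rank a, mem_vonNeumann.1 ha, ?_⟩
      rw [hao.toZFSet_rank_eq]
      exact (hJ a ha w haw).symm
    · rintro ⟨a, ha, rfl⟩
      have haV := toZFSet_mem_vonNeumann.2 ha
      obtain ⟨y, hy, hay⟩ := hc.total _ haV
      exact ⟨⟨y, hy⟩, (htop y hy).2 ⟨_, haV, isOrdinal_toZFSet a, hay⟩, hJ _ haV ⟨y, hy⟩ hay⟩
  · intro q x hx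
    obtain ⟨y, hy, hxy⟩ := hc.total x hx
    have h1 := hJ x hx ⟨y, hy⟩ hxy
    have hpair : pair (num q) x ∈ V_ κ.ord :=
      pair_mem_vonNeumann hlim.isSuccPrelimit (num_mem_vonNeumann hlim q) hx
    have h2 := hc.pred x hx y hy hxy q
    rw [pair_mem_tagged] at h2
    simp only [hpair, true_and] at h2
    rw [ZFSet.mem_sep, h2]
    constructor
    · rintro ⟨-, z, hz, hzB⟩
      rw [← h1] at hz
      rwa [hcinj hz] at hzB
    · exact fun h => ⟨hsub hx, _, h1, h⟩
  · let M := Str (range c) (fun q => (range c).sep fun z => ∃ y : N, c y = z ∧ y.val ∈ B q)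
    let e : M → N := fun x => Classical.choose (mem_range.1 x.mem)
    have he : ∀ x : M, c (e x) = x.val := fun x => Classical.choose_spec (mem_range.1 x.mem)
    have hinj : Function.Injective e := fun x y h => Str.ext (by rw [← he, ← he, h])
    have hsurj : Function.Surjective e := fun y =>
      ⟨⟨c y, mem_range_self y⟩, hcinj (he ⟨c y, mem_range_self y⟩)⟩
    refine ((codeInterp_interprets hV hE e ⟨hinj, hsurj⟩ ?_ ?_).realize_tr φ default _ _ default
      default (Subsingleton.elim _ _) (fun i => i.elim0)).1 hφ
    · intro a b
      change a.val ∈ b.val ↔ R (e a) (e b)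
      rw [← he, ← he]
      exact collapse_mem_collapse hR hext
    · intro q a
      change a.val ∈ ZFSet.sep _ _ ↔ _
      rw [ZFSet.mem_sep, ← he]
      constructor
      · rintro ⟨-, y, hy, h⟩
        rwa [← hcinj hy]
      · exact fun h => ⟨mem_range_self _, _, rfl, h⟩

/-- The pair of `V_a` with itself has rank `a + 2`. Including closure under pairs in the reflected
sentence thus ensures that the reflecting ordinal is a limit, so that relations on `V_o` are coded
by subsets of `V_o`. -/
lemma isSuccLimit_of_pair_mem {o : Ordinal.{u}} (hne : ∃ x, x ∈ V_ o)
    (h : ∀ x ∈ V_ o, ∀ y ∈ V_ o, pair x y ∈ V_ o) : Order.IsSuccLimit o := by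
  have hpos : 0 < o := by
    obtain ⟨x, hx⟩ := hne
    exact zero_le.trans_lt (mem_vonNeumann.1 hx)
  refine ⟨by simpa using hpos.ne', Order.isSuccPrelimit_of_succ_lt fun a ha => ?_⟩
  have := h (V_ a) (by simpa using ha) (V_ a) (by simpa using ha)
  rw [mem_vonNeumann, pair, rank_pair, rank_singleton, rank_pair, rank_vonNeumann, max_self,
    max_self] at this
  exact (Order.lt_succ _).trans this

lemma card_setLang_le {P : Type} [Countable P] : (setLang P).card ≤ Cardinal.aleph0 := by
  have h1 : Countable (Σ l, (setLang P).Functions l) :=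
    ⟨⟨fun f => Empty.elim f.2, fun f => Empty.elim f.2⟩⟩
  have h2 : Countable (Σ l, (setLang P).Relations l) := by
    let f : Option P → Σ l, (setLang P).Relations l := fun o =>
      o.elim ⟨2, (SetRel.mem : SetRel P 2)⟩ fun p => ⟨1, (SetRel.pred p : SetRel P 1)⟩
    refine Function.Surjective.countable (f := f) ?_
    rintro ⟨l, R⟩
    cases R with
    | mem => exact ⟨none, rfl⟩
    | pred p => exact ⟨some p, rfl⟩
  have : Countable (setLang P).Symbols := by
    unfold Language.Symbols
    infer_instance
  exact Cardinal.mk_le_aleph0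

/-- Extensionality passes from `D` to `S` by elementarity; this gives the extensionality clause of a
code. -/
lemma ElementarySubstructure.exists_mem_iff_notMem {P : Type} {D : ZFSet.{u}}
    {I : P → ZFSet.{u}} (S : (setLang P).ElementarySubstructure (Str D I)) (hD : D.IsTransitive)
    {a b : S} (h : a.1.val ≠ b.1.val) : ∃ c : S, ¬ (c.1.val ∈ a.1.val ↔ c.1.val ∈ b.1.val) := by
  have key : ∃ z ∈ D, ¬ (z ∈ a.1.val ↔ z ∈ b.1.val) := by
    by_contra hcon
    push Not at hcon
    refine h (ZFSet.ext fun z => ⟨fun hz => ?_, fun hz => ?_⟩)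
    · exact (hcon z (hD.subset_of_mem a.1.mem hz)).1 hz
    · exact (hcon z (hD.subset_of_mem b.1.mem hz)).2 hz
  let χ : (setLang P).Formula (Option Bool) :=
    ∼ (BoundedFormula.iff (fMem none (some true)) (fMem none (some false)))
  let v : Bool → S := fun t => cond t a b
  have h1 : (fEx χ).Realize (S.subtype ∘ v) := by
    obtain ⟨z, hz, h⟩ := key
    rw [realize_fEx]
    refine ⟨z, hz, ?_⟩
    simp only [χ, Formula.realize_not, realize_fIff, realize_fMem]
    exact h
  rw [S.subtype.map_formula, fEx, Formula.realize_not, realize_fAll'] at h1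
  push Not at h1
  obtain ⟨c, hc⟩ := h1
  refine ⟨c, ?_⟩
  rw [Formula.realize_not, not_not, ← S.subtype.map_formula] at hc
  simp only [χ, Formula.realize_not, realize_fIff, realize_fMem] at hc
  exact hc

/-- Downward Löwenheim–Skolem with the exact cardinality `|V_o|`, which is infinite because `o` is a
limit; the language is countable. -/
lemma exists_elementarySubstructure_equiv {r : ℕ} {o κ : Ordinal.{u}} (ho : Order.IsSuccLimit o)
    (hoκ : o < κ) (I : Fin r → ZFSet.{u}) :
    ∃ S : (setLang (Fin r)).ElementarySubstructure (Str (V_ κ) I),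
      (∀ x : Str (V_ κ) I, x.val ∈ V_ o ∨ x.val = o.toZFSet → x ∈ S) ∧ Nonempty (S ≃ V_ o) := by
  have hsub : V_ o ⊆ V_ κ := vonNeumann_subset_of_le hoκ.le
  let s₀ : Set (Str (V_ κ) I) := {x | x.val ∈ V_ o}
  let t : Str (V_ κ) I := ⟨o.toZFSet, toZFSet_mem_vonNeumann.2 hoκ⟩
  have hs₀ : Cardinal.mk s₀ = Cardinal.mk (V_ o) := Cardinal.mk_congr
    ⟨fun x => ⟨x.1.val, x.2⟩, fun x => ⟨⟨x.1, hsub x.2⟩, x.2⟩, fun _ => rfl, fun _ => rfl⟩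
  have hinf : Cardinal.aleph0 ≤ Cardinal.mk (V_ o) := by
    have : Function.Injective (fun n : ℕ => (⟨num n, num_mem_vonNeumann ho n⟩ : V_ o)) :=
      fun m n h => num_inj.1 (congrArg Subtype.val h)
    have := Cardinal.lift_mk_le_lift_mk_of_injective this
    simpa using this
  obtain ⟨S, hS, hcard⟩ := exists_elementarySubstructure_card_eq (setLang (Fin r))
    (insert t s₀) (Cardinal.mk (V_ o)) hinf
    (by
      rw [Cardinal.lift_id, Cardinal.lift_id]
      refine Cardinal.mk_insert_le.trans ?_
      rw [hs₀, Cardinal.add_one_eq hinf])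
    (by
      refine le_trans ?_ (Cardinal.lift_le.2 hinf)
      rw [Cardinal.lift_aleph0, Cardinal.lift_le_aleph0]
      exact card_setLang_le)
    (by
      rw [Cardinal.lift_id, Cardinal.lift_id, ← hs₀]
      exact Cardinal.mk_set_le s₀)
  refine ⟨S, fun x hx => hS ?_, ?_⟩
  · rcases hx with hx | hx
    · exact Set.mem_insert_of_mem _ hx
    · exact Set.mem_insert_iff.2 (.inl (Str.ext hx))
  · rw [Cardinal.lift_id, Cardinal.lift_id] at hcard
    exact Cardinal.eq.1 hcard

/-- The code is an elementary substructure of `V_κ` containing `V_o ∪ {o}`, transported to `V_o` by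
a bijection. Elementarity gives the truth of `φ` and extensionality; well-foundedness is inherited
from `∈`. -/
lemma exists_isCode {r : ℕ} {o κ : Ordinal.{u}} (ho : Order.IsSuccLimit o) (hoκ : o < κ)
    (I : Fin r → ZFSet.{u}) (φ : (setLang (Fin r)).Sentence) (hφ : Str (V_ κ) I ⊨ φ) :
    ∃ (E J : ZFSet.{u}) (B : Fin r → ZFSet.{u}), E ⊆ V_ o ∧ J ⊆ V_ o ∧ (∀ q, B q ⊆ V_ o) ∧
      IsCode (V_ o) (tagged (V_ κ) I ∩ V_ o) E J B ∧
      Str (V_ o) (Sum.elim (fun _ : Unit => tagged (V_ κ) I ∩ V_ o) (codeVars E J B)) ⊨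
        ((codeInterp r).tr φ Empty.elim Fin.elim0 :
          (setLang (Unit ⊕ Fin (r + 2))).Formula Empty) := by
  have hsub : V_ o ⊆ V_ κ := vonNeumann_subset_of_le hoκ.le
  have hV := isTransitive_vonNeumann o
  obtain ⟨S, hS, ⟨e⟩⟩ := exists_elementarySubstructure_equiv ho hoκ I
  classical
  -- The map `g` sends a point of `V_o` to the element of `S` it stands for; `∅` is a dummy value
  -- outside `V_o`. Below, `E` and `B` are pulled back along `g`, and `J` relates `x` to the point
  -- standing for `x`.
  let g : ZFSet.{u} → ZFSet.{u} := fun x => if h : x ∈ V_ o then (e.symm ⟨x, h⟩).1.val else ∅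
  have hg : ∀ a : S, g (e a).1 = a.1.val := fun a => by
    simp only [g, dif_pos (e a).2, Subtype.coe_eta, Equiv.symm_apply_apply]
  have hgS : ∀ x ∈ V_ o, ∃ a : S, (e a).1 = x := fun x hx => ⟨e.symm ⟨x, hx⟩, by simp⟩
  have hgmem : ∀ x, (∃ h : x ∈ V_ κ, (⟨x, h⟩ : Str (V_ κ) I) ∈ S) → ∃ y ∈ V_ o, g y = x := by
    rintro x ⟨h1, h2⟩
    exact ⟨_, (e ⟨_, h2⟩).2, hg ⟨_, h2⟩⟩
  have hpair : ∀ x ∈ V_ o, ∀ y ∈ V_ o, pair x y ∈ V_ o := fun x hx y hy =>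
    pair_mem_vonNeumann ho.isSuccPrelimit hx hy
  let E := (V_ o).sep fun z => ∃ x y, z = pair x y ∧ g x ∈ g y
  let J := (V_ o).sep fun z => ∃ x y, z = pair x y ∧ g y = x
  let B : Fin r → ZFSet.{u} := fun q => (V_ o).sep fun z => g z ∈ I q
  have hE : ∀ x ∈ V_ o, ∀ y ∈ V_ o, pair x y ∈ E ↔ g x ∈ g y := by
    intro x hx y hy
    simp only [E, ZFSet.mem_sep, hpair x hx y hy, true_and, pair_inj]
    exact ⟨by rintro ⟨_, _, ⟨rfl, rfl⟩, h⟩; exact h, fun h => ⟨x, y, ⟨rfl, rfl⟩, h⟩⟩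
  have hJ : ∀ x ∈ V_ o, ∀ y ∈ V_ o, pair x y ∈ J ↔ g y = x := by
    intro x hx y hy
    simp only [J, ZFSet.mem_sep, hpair x hx y hy, true_and, pair_inj]
    exact ⟨by rintro ⟨_, _, ⟨rfl, rfl⟩, h⟩; exact h, fun h => ⟨x, y, ⟨rfl, rfl⟩, h⟩⟩
  have hB : ∀ q, ∀ x ∈ V_ o, x ∈ B q ↔ g x ∈ I q := by
    intro q x hx
    simp only [B, ZFSet.mem_sep, hx, true_and]
  refine ⟨E, J, B, ZFSet.sep_subset, ZFSet.sep_subset, fun q => ZFSet.sep_subset, ?_, ?_⟩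
  · constructor
    · rintro b - ⟨x, hx, hxb⟩
      obtain ⟨z, ⟨y, ⟨hy, hyb⟩, rfl⟩, hmin⟩ := mem_wf.has_min (g '' {x | x ∈ V_ o ∧ x ∈ b})
        ⟨_, x, ⟨hx, hxb⟩, rfl⟩
      refine ⟨y, hy, hyb, fun w hw hwb hwy => ?_⟩
      exact hmin (g w) ⟨w, ⟨hw, hwb⟩, rfl⟩ ((hE w hw y hy).1 hwy)
    · intro x hx y hy hxy
      obtain ⟨a, rfl⟩ := hgS x hx
      obtain ⟨b, rfl⟩ := hgS y hy
      by_contra hne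
      have hab : a.1.val ≠ b.1.val := fun h => hne (by rw [Subtype.ext (Str.ext h)])
      obtain ⟨c, hc⟩ :=
        ElementarySubstructure.exists_mem_iff_notMem S (isTransitive_vonNeumann κ) hab
      refine hc ?_
      have := hxy _ (e c).2
      rwa [hE _ (e c).2 _ hx, hE _ (e c).2 _ hy, hg, hg, hg] at this
    · intro x hx
      obtain ⟨y, hy, hyx⟩ := hgmem x ⟨hsub hx, hS _ (.inl hx)⟩
      exact ⟨y, hy, (hJ x hx y hy).2 hyx⟩
    · intro x hx y hy hxy z hz
      rw [hJ x hx y hy] at hxy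
      rw [hE z hz y hy, hxy]
      constructor
      · exact fun h => ⟨g z, hV.subset_of_mem hx h, h,
          (hJ _ (hV.subset_of_mem hx h) z hz).2 rfl⟩
      · rintro ⟨w, hw, hwx, hwz⟩
        rwa [(hJ w hw z hz).1 hwz]
    · obtain ⟨c, hc, hco⟩ := hgmem o.toZFSet
        ⟨toZFSet_mem_vonNeumann.2 hoκ, hS _ (.inr rfl)⟩
      refine ⟨c, hc, fun z hz => ?_⟩
      rw [hE z hz c hc, hco, Ordinal.mem_toZFSet_iff]
      constructor
      · rintro ⟨a, ha, haz⟩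
        have haV := toZFSet_mem_vonNeumann.2 ha
        exact ⟨_, haV, isOrdinal_toZFSet a, (hJ _ haV z hz).2 haz.symm⟩
      · rintro ⟨w, hw, hwo, hwz⟩
        exact ⟨rank w, mem_vonNeumann.1 hw, by
          rw [hwo.toZFSet_rank_eq, (hJ w hw z hz).1 hwz]⟩
    · intro x hx y hy hxy q
      have hp := hpair _ (num_mem_vonNeumann ho q) x hx
      rw [hB q y hy, (hJ x hx y hy).1 hxy, ZFSet.mem_inter, pair_mem_tagged]
      exact ⟨fun h => h.2.1.2, fun h => ⟨hp, ⟨hsub hp, h⟩, hp⟩⟩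
  · let e' : S → Str (V_ o) (Sum.elim (fun _ : Unit => tagged (V_ κ) I ∩ V_ o)
      (codeVars E J B)) := fun a => ⟨(e a).1, (e a).2⟩
    have he' : Function.Bijective e' := by
      constructor
      · intro a b h
        exact e.injective (Subtype.ext (congrArg (fun z => Str.val z) h :))
      · intro y
        obtain ⟨a, ha⟩ := hgS y.val y.mem
        exact ⟨a, Str.ext ha⟩
    refine ((codeInterp_interprets hV ZFSet.sep_subset e' he' ?_ ?_).realize_tr φ default _ _
      default default (Subsingleton.elim _ _) (fun i => i.elim0)).2 ((S.realize_sentence φ).2 hφ)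
    · intro a b
      rw [hE _ (e a).2 _ (e b).2, hg, hg]
      exact Iff.rfl
    · intro q a
      rw [hB q _ (e a).2, hg]
      exact Iff.rfl

/-- If `κ` is `Π¹₁` reflecting, then every sentence true in an expansion of `(V_κ, ∈)` by finitely
many definable predicates is true in a transitive extension containing `κ`. -/
theorem IsPi11Reflecting.exists_extension {r : ℕ} {κ : Cardinal.{u}} (h : IsPi11Reflecting κ)
    {I : Fin r → ZFSet.{u}} (hI : ∀ q, IsDefinableSubset (V_ κ.ord) (I q))
    (φ : (setLang (Fin r)).Sentence) (hφ : Str (V_ κ.ord) I ⊨ φ) :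
    ∃ (X : ZFSet.{u}) (I' : Fin r → ZFSet.{u}), X.IsTransitive ∧ (∀ q, I' q ⊆ X) ∧
      κ.ord.toZFSet ∈ X ∧ V_ κ.ord ⊆ X ∧ (∀ q, ∀ x ∈ V_ κ.ord, x ∈ I' q ↔ x ∈ I q) ∧
      Str X I' ⊨ φ := by
  have hlim := IsInaccessible.isSuccLimit_ord h.1
  have hV := isTransitive_vonNeumann κ.ord
  by_contra hcon
  -- If no extension exists, no choice of second-order variables is a code, since a code would
  -- collapse to an extension.
  have hsat : SatPi11 (V_ κ.ord) (tagged (V_ κ.ord) I) (noCodeSentence φ) := by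
    intro Y hY
    obtain ⟨E, J, B, rfl⟩ : ∃ E J B, Y = codeVars E J B :=
      ⟨Y 0, Y 1, fun q => Y q.succ.succ, by
        funext i
        refine Fin.cases rfl (fun i => Fin.cases rfl (fun i => rfl) i) i⟩
    rw [Sentence.Realize, noCodeSentence, Formula.realize_inf, Formula.realize_not,
      Formula.realize_inf]
    refine ⟨(realize_pairSentence hV).2 ⟨⟨_, num_mem_vonNeumann hlim 0⟩, fun x hx y hy =>
      pair_mem_vonNeumann hlim.isSuccPrelimit hx hy⟩, fun ⟨h1, h2⟩ => hcon ?_⟩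
    exact exists_extension_of_isCode h.1 (hY 0)
      ((realize_codeSentence hV (hY 0) (hY 1)).1 h1) φ h2
  obtain ⟨o, ho, hosat⟩ := h.2 _ (isDefinableSubset_tagged hV hI) _ _ hsat
  have hVo := isTransitive_vonNeumann o
  -- The conjunct `pairSentence` does not mention the second-order variables, so any instance yields
  -- it.
  have hpair := hosat (fun _ => ∅) (fun _ => ZFSet.empty_subset _)
  rw [Sentence.Realize, noCodeSentence, Formula.realize_inf] at hpair
  obtain ⟨hne, hp⟩ := (realize_pairSentence hVo).1 hpair.1
  have hol := isSuccLimit_of_pair_mem hne hp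
  obtain ⟨E, J, B, hE, hJ, hB, hc, ht⟩ := exists_isCode hol ho I φ hφ
  have := hosat (codeVars E J B) (fun i => by
    refine Fin.cases hE (fun i => Fin.cases hJ (fun i => hB i) i) i)
  rw [Sentence.Realize, noCodeSentence, Formula.realize_inf, Formula.realize_not,
    Formula.realize_inf] at this
  exact this.2 ⟨(realize_codeSentence hVo hE hJ).2 hc, ht⟩

/-! ### Assignments coded by sets -/

section Assignments

/-- The value at `i` of the assignment coded by `s`. -/
noncomputable def val (s i : ZFSet.{u}) : ZFSet.{u} :=
  (⋃₀ (⋃₀ s : ZFSet) : ZFSet).sep fun y => pair i y ∈ s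

lemma mem_val {s i y : ZFSet.{u}} : y ∈ val s i ↔ pair i y ∈ s := by
  rw [val, ZFSet.mem_sep, and_iff_right_iff_imp]
  intro h
  refine mem_sUnion_of_mem (z := {i, y}) (by simp) (mem_sUnion_of_mem ?_ h)
  simp [pair]

/-- The assignments `s` and `t` agree at the numerals below `m`. -/
def Agree (m : ℕ) (s t : ZFSet.{u}) : Prop :=
  ∀ i < m, val s (num i) = val t (num i)

lemma Agree.trans {m : ℕ} {s t w : ZFSet.{u}} (h1 : Agree m s t) (h2 : Agree m t w) :
    Agree m s w := fun i hi => (h1 i hi).trans (h2 i hi)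

lemma Agree.mono {m n : ℕ} {s t : ZFSet.{u}} (h : Agree n s t) (hmn : m ≤ n) : Agree m s t :=
  fun i hi => h i (hi.trans_le hmn)

lemma agree_refl (m : ℕ) (s : ZFSet.{u}) : Agree m s s := fun _ _ => rfl

/-- `D` is a transitive set containing the numerals and closed under the basic operations on
assignments. -/
structure IsAssignmentClosed (D : ZFSet.{u}) : Prop where
  trans : D.IsTransitive
  num_mem : ∀ n, num n ∈ D
  val_mem : ∀ s ∈ D, ∀ i ∈ D, val s i ∈ D
  update : ∀ s ∈ D, ∀ m ∈ D, ∀ x ∈ D, ∃ t ∈ D, (∀ i ∈ m, val s i = val t i) ∧ val t m = x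

lemma IsAssignmentClosed.exists_agree {D : ZFSet.{u}} (hD : IsAssignmentClosed D) {s x : ZFSet.{u}}
    (hs : s ∈ D) (m : ℕ) (hx : x ∈ D) : ∃ t ∈ D, Agree m s t ∧ val t (num m) = x := by
  obtain ⟨t, ht, h1, h2⟩ := hD.update s hs _ (hD.num_mem m) x hx
  exact ⟨t, ht, fun i hi => h1 _ (num_mem_num.2 hi), h2⟩

lemma isAssignmentClosed_vonNeumann {o : Ordinal.{u}} (ho : Order.IsSuccLimit o) :
    IsAssignmentClosed (V_ o) where
  trans := isTransitive_vonNeumann o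
  num_mem := num_mem_vonNeumann ho
  val_mem s hs i _ := by
    refine mem_vonNeumann_of_subset ZFSet.sep_subset (y := ⋃₀ (⋃₀ s : ZFSet)) ?_
    rw [mem_vonNeumann] at *
    exact ((rank_sUnion_le _).trans (rank_sUnion_le _)).trans_lt hs
  update s hs m hm x hx := by
    -- Since the value at `m` is the section of `s` at `m`, an update deletes all pairs with first
    -- entry `m` and adds `{m} × x`.
    refine ⟨s.sep (fun z => ¬ ∃ y, z = pair m y) ∪ prod {m} x, ?_, fun i hi => ?_, ?_⟩
    · refine mem_vonNeumann_of_subset (y := s ∪ powerset (powerset ({m} ∪ x))) ?_ ?_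
      · intro z hz
        rw [ZFSet.mem_union] at hz ⊢
        rcases hz with hz | hz
        · exact .inl (ZFSet.mem_sep.1 hz).1
        · rw [prod, pairSep] at hz
          exact .inr (ZFSet.mem_sep.1 hz).1
      · rw [mem_vonNeumann] at *
        simp only [rank_union, rank_powerset, rank_singleton, max_lt_iff]
        refine ⟨hs, ho.succ_lt (ho.succ_lt (max_lt (ho.succ_lt hm) hx))⟩
    · have him : i ≠ m := fun h => mem_irrefl m (h ▸ hi)
      ext y
      simp [mem_val, him]
    · ext y
      simp [mem_val]

variable {D A : ZFSet.{u}} (hD : IsAssignmentClosed D)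

/-- The assignment coded by `s`. -/
noncomputable def asg (A : ZFSet.{u}) {s : ZFSet.{u}} (hs : s ∈ D) (m : ℕ) :
    Fin m → Str D (fun _ : Unit => A) :=
  fun i => ⟨val s (num i), hD.val_mem s hs _ (hD.num_mem i)⟩

lemma asg_congr {s t : ZFSet.{u}} (hs : s ∈ D) (ht : t ∈ D) {m : ℕ} (h : Agree m s t) :
    asg hD A hs m = asg hD A ht m := by
  funext i
  exact Str.ext (h i i.2)

lemma asg_succ {s t : ZFSet.{u}} (hs : s ∈ D) (ht : t ∈ D) {m : ℕ} (h : Agree m s t)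
    {x : Str D (fun _ : Unit => A)} (hx : val t (num m) = x.val) :
    asg hD A ht (m + 1) = Fin.snoc (asg hD A hs m) x := by
  funext i
  refine Fin.lastCases ?_ (fun i => ?_) i
  · rw [Fin.snoc_last]
    exact Str.ext hx
  · rw [Fin.snoc_castSucc]
    exact Str.ext (h i i.2).symm

lemma exists_asg_eq {m : ℕ} (v : Fin m → Str D (fun _ : Unit => A)) :
    ∃ s, ∃ hs : s ∈ D, asg hD A hs m = v := by
  induction m with
  | zero => exact ⟨_, hD.num_mem 0, Subsingleton.elim _ _⟩
  | succ m ih =>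
    obtain ⟨s, hs, h⟩ := ih (fun i => v i.castSucc)
    obtain ⟨t, ht, h1, h2⟩ := hD.exists_agree hs m (v (Fin.last m)).mem
    refine ⟨t, ht, ?_⟩
    rw [asg_succ hD hs ht h1 h2, h]
    exact Fin.snoc_init_self v

lemma realize_all_asg {s : ZFSet.{u}} (hs : s ∈ D) {m : ℕ}
    (φ : (setLang Unit).BoundedFormula Empty (m + 1)) :
    φ.all.Realize Empty.elim (asg hD A hs m) ↔
      ∀ t (ht : t ∈ D), Agree m s t → φ.Realize Empty.elim (asg hD A ht (m + 1)) := by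
  rw [BoundedFormula.realize_all]
  constructor
  · intro H t ht h
    rw [asg_succ hD hs ht h (x := ⟨val t (num m), hD.val_mem t ht _ (hD.num_mem m)⟩) rfl]
    exact H _
  · intro H x
    obtain ⟨t, ht, h1, h2⟩ := hD.exists_agree hs m x.mem
    rw [← asg_succ hD hs ht h1 h2]
    exact H t ht h1

lemma realize_ex_asg {s : ZFSet.{u}} (hs : s ∈ D) {m : ℕ}
    (φ : (setLang Unit).BoundedFormula Empty (m + 1)) :
    φ.ex.Realize Empty.elim (asg hD A hs m) ↔
      ∃ t, ∃ ht : t ∈ D, Agree m s t ∧ φ.Realize Empty.elim (asg hD A ht (m + 1)) := by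
  rw [BoundedFormula.realize_ex]
  constructor
  · rintro ⟨x, hx⟩
    obtain ⟨t, ht, h1, h2⟩ := hD.exists_agree hs m x.mem
    rw [← asg_succ hD hs ht h1 h2] at hx
    exact ⟨t, ht, h1, hx⟩
  · rintro ⟨t, ht, h, H⟩
    rw [asg_succ hD hs ht h (x := ⟨val t (num m), hD.val_mem t ht _ (hD.num_mem m)⟩) rfl] at H
    exact ⟨_, H⟩

end Assignments

/-! ### Blocks of quantifiers -/

section Blocks

/-- The second formula is a block of universal quantifiers followed by `ψ`. -/
inductive AllBlock {l : ℕ} (ψ : (setLang Unit).BoundedFormula Empty l) :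
    ∀ {m : ℕ}, (setLang Unit).BoundedFormula Empty m → Prop
  | refl : AllBlock ψ ψ
  | all {m : ℕ} {φ : (setLang Unit).BoundedFormula Empty (m + 1)} :
      AllBlock ψ φ → AllBlock ψ φ.all

/-- The second formula is a block of existential quantifiers followed by `ψ`. -/
inductive ExBlock {l : ℕ} (ψ : (setLang Unit).BoundedFormula Empty l) :
    ∀ {m : ℕ}, (setLang Unit).BoundedFormula Empty m → Prop
  | refl : ExBlock ψ ψ
  | ex {m : ℕ} {φ : (setLang Unit).BoundedFormula Empty (m + 1)} :
      ExBlock ψ φ → ExBlock ψ φ.ex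

/-- The formulas with at most `n` blocks of quantifiers in front of a `Δ₀` formula. -/
def HasBlocks : ℕ → ∀ {m : ℕ}, (setLang Unit).BoundedFormula Empty m → Prop
  | 0, _, φ => IsDelta0 φ
  | n + 1, _, φ => ∃ (l : ℕ) (ψ : (setLang Unit).BoundedFormula Empty l),
      HasBlocks n ψ ∧ (AllBlock ψ φ ∨ ExBlock ψ φ)

lemma IsSigma.hasBlocks {n m : ℕ} {φ : (setLang Unit).BoundedFormula Empty m}
    (h : IsSigma n φ) : HasBlocks n φ := by
  -- The induction over the two mutual hierarchies must remember whether the outer block is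
  -- existential or universal, which `HasBlocks` forgets.
  let MS : ∀ (n : ℕ) {m : ℕ}, (setLang Unit).BoundedFormula Empty m → Prop := fun n _ φ =>
    match n with
    | 0 => IsDelta0 φ
    | n + 1 => ∃ (l : ℕ) (ψ : (setLang Unit).BoundedFormula Empty l), HasBlocks n ψ ∧ ExBlock ψ φ
  let MP : ∀ (n : ℕ) {m : ℕ}, (setLang Unit).BoundedFormula Empty m → Prop := fun n _ φ =>
    match n with
    | 0 => IsDelta0 φ
    | n + 1 => ∃ (l : ℕ) (ψ : (setLang Unit).BoundedFormula Empty l), HasBlocks n ψ ∧ AllBlock ψ φ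
  have hS : ∀ {n m : ℕ} {φ : (setLang Unit).BoundedFormula Empty m}, MS n φ → HasBlocks n φ := by
    intro n m φ h
    cases n with
    | zero => exact h
    | succ n =>
      obtain ⟨l, ψ, h1, h2⟩ := h
      exact ⟨l, ψ, h1, .inr h2⟩
  have hP : ∀ {n m : ℕ} {φ : (setLang Unit).BoundedFormula Empty m}, MP n φ → HasBlocks n φ := by
    intro n m φ h
    cases n with
    | zero => exact h
    | succ n =>
      obtain ⟨l, ψ, h1, h2⟩ := h
      exact ⟨l, ψ, h1, .inl h2⟩
  refine hS (IsSigma.rec (motive_1 := fun n _ φ _ => MS n φ) (motive_2 := fun n _ φ _ => MP n φ)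
    ?_ ?_ ?_ ?_ ?_ ?_ h)
  · exact fun h => h
  · exact fun _ ih => ⟨_, _, hP ih, .refl⟩
  · rintro n m φ _ ⟨l, ψ, h1, h2⟩
    exact ⟨l, ψ, h1, .ex h2⟩
  · exact fun h => h
  · exact fun _ ih => ⟨_, _, hS ih, .refl⟩
  · rintro n m φ _ ⟨l, ψ, h1, h2⟩
    exact ⟨l, ψ, h1, .all h2⟩

variable {D A : ZFSet.{u}} (hD : IsAssignmentClosed D)
include hD

/-- A whole block of quantifiers becomes one quantifier over assignments extending `s` beyond the
first `m` variables. Truth for `n` blocks therefore needs only `n` such quantifiers, whatever the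
lengths of the blocks. -/
lemma AllBlock.realize_asg {l m : ℕ} {ψ : (setLang Unit).BoundedFormula Empty l}
    {φ : (setLang Unit).BoundedFormula Empty m} (h : AllBlock ψ φ) {s : ZFSet.{u}} (hs : s ∈ D) :
    φ.Realize Empty.elim (asg hD A hs m) ↔
      ∀ t (ht : t ∈ D), Agree m s t → ψ.Realize Empty.elim (asg hD A ht l) := by
  induction h generalizing s with
  | refl =>
    refine ⟨fun H t ht h => ?_, fun H => H s hs (agree_refl _ s)⟩
    rwa [← asg_congr hD hs ht h]
  | all _ ih =>
    rw [realize_all_asg]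
    simp only [ih]
    exact ⟨fun H t ht h => H t ht h t ht (agree_refl _ t),
      fun H t _ h w hw h' => H w hw (h.trans (h'.mono (Nat.le_succ _)))⟩

lemma ExBlock.realize_asg {l m : ℕ} {ψ : (setLang Unit).BoundedFormula Empty l}
    {φ : (setLang Unit).BoundedFormula Empty m} (h : ExBlock ψ φ) {s : ZFSet.{u}} (hs : s ∈ D) :
    φ.Realize Empty.elim (asg hD A hs m) ↔
      ∃ t, ∃ ht : t ∈ D, Agree m s t ∧ ψ.Realize Empty.elim (asg hD A ht l) := by
  induction h generalizing s with
  | refl =>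
    refine ⟨fun H => ⟨s, hs, agree_refl _ s, H⟩, fun ⟨t, ht, h, H⟩ => ?_⟩
    rwa [asg_congr hD hs ht h]
  | ex _ ih =>
    rw [realize_ex_asg]
    simp only [ih]
    exact ⟨fun ⟨t, _, h, w, hw, h', H⟩ => ⟨w, hw, h.trans (h'.mono (Nat.le_succ _)), H⟩,
      fun ⟨t, ht, h, H⟩ => ⟨t, ht, h, t, ht, agree_refl _ t, H⟩⟩

end Blocks

/-! ### Codes of formulas -/

section Coding

/-- A code of a formula. -/
noncomputable def code {m : ℕ} (φ : (setLang Unit).BoundedFormula Empty m) : ℕ :=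
  have : Countable (setLang Unit).Symbols := Cardinal.mk_le_aleph0_iff.1 card_setLang_le
  Classical.choose (exists_injective_nat (Σ m, (setLang Unit).BoundedFormula Empty m)) ⟨m, φ⟩

lemma code_inj {m l : ℕ} {φ : (setLang Unit).BoundedFormula Empty m}
    {ψ : (setLang Unit).BoundedFormula Empty l} (h : code φ = code ψ) :
    (⟨m, φ⟩ : Σ m, (setLang Unit).BoundedFormula Empty m) = ⟨l, ψ⟩ :=
  have : Countable (setLang Unit).Symbols := Cardinal.mk_le_aleph0_iff.1 card_setLang_le
  Classical.choose_spec (exists_injective_nat (Σ m, (setLang Unit).BoundedFormula Empty m)) h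

/-- The kinds of syntactic information about formulas. -/
inductive SynKind
  | delta0 | falsum | equal | mem | pred | imp | ball | allBlock | exBlock

instance : Finite SynKind := by
  refine Finite.of_surjective (fun n : Fin 9 => (![.delta0, .falsum, .equal, .mem, .pred, .imp,
    .ball, .allBlock, .exBlock] : Fin 9 → SynKind) n) ?_
  rintro (_ | _ | _ | _ | _ | _ | _ | _ | _)
  exacts [⟨0, rfl⟩, ⟨1, rfl⟩, ⟨2, rfl⟩, ⟨3, rfl⟩, ⟨4, rfl⟩, ⟨5, rfl⟩, ⟨6, rfl⟩, ⟨7, rfl⟩,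
    ⟨8, rfl⟩]

/-- The formula with the code `a` is built in the given way from the data `b`, `c`, `d`. -/
def SynRel : SynKind → ℕ → ℕ → ℕ → ℕ → Prop
  | .delta0, a, _, _, _ => ∃ (m : ℕ) (φ : (setLang Unit).BoundedFormula Empty m),
      IsDelta0 φ ∧ a = code φ
  | .falsum, a, _, _, _ => ∃ m : ℕ, a = code (.falsum : (setLang Unit).BoundedFormula Empty m)
  | .equal, a, b, c, _ => ∃ (m : ℕ) (s t : (setLang Unit).Term (Empty ⊕ Fin m)),
      a = code (.equal s t) ∧ b = varIdx s ∧ c = varIdx t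
  | .mem, a, b, c, _ => ∃ (m : ℕ) (ts : Fin 2 → (setLang Unit).Term (Empty ⊕ Fin m)),
      a = code (.rel (SetRel.mem : SetRel Unit 2) ts) ∧ b = varIdx (ts 0) ∧ c = varIdx (ts 1)
  | .pred, a, b, _, _ => ∃ (m : ℕ) (ts : Fin 1 → (setLang Unit).Term (Empty ⊕ Fin m)),
      a = code (.rel (SetRel.pred () : SetRel Unit 1) ts) ∧ b = varIdx (ts 0)
  | .imp, a, b, c, _ => ∃ (m : ℕ) (φ ψ : (setLang Unit).BoundedFormula Empty m),
      a = code (φ.imp ψ) ∧ b = code φ ∧ c = code ψ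
  | .ball, a, b, c, d => ∃ (m : ℕ) (y : Fin m) (φ : (setLang Unit).BoundedFormula Empty (m + 1)),
      a = code ((memFormula (Fin.last m) y.castSucc).imp φ).all ∧ b = code φ ∧ c = m ∧ d = y
  | .allBlock, a, b, c, _ => ∃ (m l : ℕ) (φ : (setLang Unit).BoundedFormula Empty m)
      (ψ : (setLang Unit).BoundedFormula Empty l),
      AllBlock ψ φ ∧ a = code φ ∧ b = code ψ ∧ c = m
  | .exBlock, a, b, c, _ => ∃ (m l : ℕ) (φ : (setLang Unit).BoundedFormula Empty m)
      (ψ : (setLang Unit).BoundedFormula Empty l),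
      ExBlock ψ φ ∧ a = code φ ∧ b = code ψ ∧ c = m

/-- The set of quadruples of numerals in the relation `SynRel k`. -/
noncomputable def synSet (k : SynKind) : ZFSet.{u} :=
  range fun x : {x : ℕ × ℕ × ℕ × ℕ // SynRel k x.1 x.2.1 x.2.2.1 x.2.2.2} =>
    pair (num x.1.1) (pair (num x.1.2.1) (pair (num x.1.2.2.1) (num x.1.2.2.2)))

lemma mem_synSet {k : SynKind} {a b c d : ZFSet.{u}} :
    pair a (pair b (pair c d)) ∈ synSet k ↔ ∃ a' b' c' d' : ℕ, SynRel k a' b' c' d' ∧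
      a = num a' ∧ b = num b' ∧ c = num c' ∧ d = num d' := by
  rw [synSet, mem_range]
  constructor
  · rintro ⟨⟨⟨a', b', c', d'⟩, h⟩, h'⟩
    simp only [pair_inj] at h'
    exact ⟨a', b', c', d', h, h'.1.symm, h'.2.1.symm, h'.2.2.1.symm, h'.2.2.2.symm⟩
  · rintro ⟨a', b', c', d', h, rfl, rfl, rfl, rfl⟩
    exact ⟨⟨⟨a', b', c', d'⟩, h⟩, rfl⟩

/-- Syntax is not arithmetized: the coding is an arbitrary injection into `ℕ`, and the relations
between codes are countable sets in `V_κ`, available as parameters. -/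
lemma synSet_mem_vonNeumann {κ : Cardinal.{u}} (hκ : κ.IsInaccessible) (k : SynKind) :
    synSet k ∈ V_ κ.ord := by
  have hlim := IsInaccessible.isSuccLimit_ord hκ
  have hn := num_mem_vonNeumann hlim
  have hp := fun {x y : ZFSet.{u}} => pair_mem_vonNeumann hlim.isSuccPrelimit (x := x) (y := y)
  exact range_mem_vonNeumann hκ fun x => hp (hn _) (hp (hn _) (hp (hn _) (hn _)))

/-- `S` is a satisfaction relation for the formulas of bounded quantification and the assignments
in `u`. -/
structure IsSat (A u S : ZFSet.{u}) : Prop where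
  falsum : ∀ a b c d, SynRel .falsum a b c d → ∀ s ∈ u, pair (num a) s ∉ S
  equal : ∀ a b c d, SynRel .equal a b c d → ∀ s ∈ u,
    pair (num a) s ∈ S ↔ val s (num b) = val s (num c)
  mem : ∀ a b c d, SynRel .mem a b c d → ∀ s ∈ u,
    pair (num a) s ∈ S ↔ val s (num b) ∈ val s (num c)
  pred : ∀ a b c d, SynRel .pred a b c d → ∀ s ∈ u, pair (num a) s ∈ S ↔ val s (num b) ∈ A
  imp : ∀ a b c d, SynRel .imp a b c d → ∀ s ∈ u,
    pair (num a) s ∈ S ↔ (pair (num b) s ∈ S → pair (num c) s ∈ S)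
  ball : ∀ a b c d, SynRel .ball a b c d → ∀ s ∈ u, pair (num a) s ∈ S ↔ ∀ t ∈ u,
    Agree c s t → val t (num c) ∈ val s (num d) → pair (num b) t ∈ S
  update : ∀ a b c d, SynRel .ball a b c d → ∀ s ∈ u, ∀ x ∈ val s (num d),
    ∃ t ∈ u, Agree c s t ∧ val t (num c) = x

-- Satisfaction relations that are sets

section Semantics

variable {D A : ZFSet.{u}} (hD : IsAssignmentClosed D)

lemma realize_term_asg {s : ZFSet.{u}} (hs : s ∈ D) {m : ℕ}
    (t : (setLang Unit).Term (Empty ⊕ Fin m)) :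
    (t.realize (Sum.elim Empty.elim (asg hD A hs m))).val = val s (num (varIdx t)) := by
  conv_lhs => rw [var_varIdx t]
  rfl

lemma realize_equal_asg {s : ZFSet.{u}} (hs : s ∈ D) {m : ℕ}
    (t t' : (setLang Unit).Term (Empty ⊕ Fin m)) :
    (BoundedFormula.equal t t').Realize Empty.elim (asg hD A hs m) ↔
      val s (num (varIdx t)) = val s (num (varIdx t')) := by
  rw [← realize_term_asg hD hs (A := A), ← realize_term_asg hD hs (A := A), ← Str.ext_iff]
  exact Iff.rfl

lemma realize_mem_asg {s : ZFSet.{u}} (hs : s ∈ D) {m : ℕ}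
    (ts : Fin 2 → (setLang Unit).Term (Empty ⊕ Fin m)) :
    (BoundedFormula.rel (L := setLang Unit) (SetRel.mem : SetRel Unit 2) ts).Realize Empty.elim
      (asg hD A hs m) ↔ val s (num (varIdx (ts 0))) ∈ val s (num (varIdx (ts 1))) := by
  rw [← realize_term_asg hD hs (A := A), ← realize_term_asg hD hs (A := A)]
  exact Iff.rfl

lemma realize_pred_asg {s : ZFSet.{u}} (hs : s ∈ D) {m : ℕ}
    (ts : Fin 1 → (setLang Unit).Term (Empty ⊕ Fin m)) :
    (BoundedFormula.rel (L := setLang Unit) (SetRel.pred () : SetRel Unit 1) ts).Realize Empty.elim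
      (asg hD A hs m) ↔ val s (num (varIdx (ts 0))) ∈ A := by
  rw [← realize_term_asg hD hs (A := A)]
  exact Iff.rfl

lemma realize_ball_asg {s : ZFSet.{u}} (hs : s ∈ D) {m : ℕ} (y : Fin m)
    (φ : (setLang Unit).BoundedFormula Empty (m + 1)) :
    ((memFormula (Fin.last m) y.castSucc).imp φ).all.Realize Empty.elim (asg hD A hs m) ↔
      ∀ t (ht : t ∈ D), Agree m s t → val t (num m) ∈ val s (num y) →
        φ.Realize Empty.elim (asg hD A ht (m + 1)) := by
  rw [realize_all_asg]
  refine forall₂_congr fun t ht => forall_congr' fun h => ?_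
  rw [BoundedFormula.realize_imp]
  have : (memFormula (P := Unit) (Fin.last m) y.castSucc).Realize Empty.elim
      (asg hD A ht (m + 1)) ↔ val t (num m) ∈ val t (num y) := Iff.rfl
  rw [this, h y y.2]

-- A set-sized satisfaction relation decides `Δ₀` truth in all of `D`, because bounded quantifiers
-- only require `u` to be closed under updates by elements of the bounding values.
include hD in
lemma IsSat.mem_iff {u S : ZFSet.{u}} (h : IsSat A u S) (hu : u ∈ D) {m : ℕ}
    {φ : (setLang Unit).BoundedFormula Empty m} (hφ : IsDelta0 φ) {s : ZFSet.{u}} (hs : s ∈ u) :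
    pair (num (code φ)) s ∈ S ↔
      φ.Realize Empty.elim (asg hD A (hD.trans.subset_of_mem hu hs) m) := by
  induction hφ generalizing s with
  | @falsum m =>
    exact iff_of_false (h.falsum _ 0 0 0 ⟨m, rfl⟩ s hs) not_false
  | equal t t' =>
    rw [h.equal _ _ _ 0 ⟨_, t, t', rfl, rfl, rfl⟩ s hs, realize_equal_asg]
  | rel R ts =>
    cases R with
    | mem => rw [h.mem _ _ _ 0 ⟨_, ts, rfl, rfl, rfl⟩ s hs, realize_mem_asg]
    | pred p => rw [h.pred _ _ 0 0 ⟨_, ts, rfl, rfl⟩ s hs, realize_pred_asg]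
  | @imp m φ ψ _ _ ih1 ih2 =>
    rw [h.imp _ _ _ 0 ⟨_, φ, ψ, rfl, rfl, rfl⟩ s hs, BoundedFormula.realize_imp, ih1 hs, ih2 hs]
  | @ball m y φ _ ih =>
    have hrel : SynRel .ball _ _ _ _ := ⟨m, y, φ, rfl, rfl, rfl, rfl⟩
    rw [h.ball _ _ _ _ hrel s hs, realize_ball_asg]
    constructor
    · intro H t ht hst hty
      -- The assignment `t` need not lie in `u`, but some `w ∈ u` has the same first `m + 1` values.
      obtain ⟨w, hw, hsw, hwt⟩ := h.update _ _ _ _ hrel s hs _ hty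
      have h1 := (ih hw).1 (H w hw hsw (by rwa [hwt]))
      rwa [asg_congr hD _ ht] at h1
      intro i hi
      rcases Nat.lt_succ_iff_lt_or_eq.1 hi with hi | rfl
      · exact (hsw i hi).symm.trans (hst i hi)
      · exact hwt
    · intro H t ht hst hty
      exact (ih ht).2 (H t _ hst hty)

/-- The set of pairs of codes of formulas and assignments in `D` satisfying them, which belong to
`u`. -/
noncomputable def satSet (A u : ZFSet.{u})
    (p : ∀ {m : ℕ}, (setLang Unit).BoundedFormula Empty m → Prop) : ZFSet.{u} :=
  u.sep fun z => ∃ (m : ℕ) (φ : (setLang Unit).BoundedFormula Empty m) (s : ZFSet.{u})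
    (hs : s ∈ D), p φ ∧ z = pair (num (code φ)) s ∧ φ.Realize Empty.elim (asg hD A hs m)

lemma mem_satSet {u : ZFSet.{u}} {p : ∀ {m : ℕ}, (setLang Unit).BoundedFormula Empty m → Prop}
    {m : ℕ} {φ : (setLang Unit).BoundedFormula Empty m} {s : ZFSet.{u}} (hs : s ∈ D)
    (hu : pair (num (code φ)) s ∈ u) :
    pair (num (code φ)) s ∈ satSet hD A u p ↔ p φ ∧ φ.Realize Empty.elim (asg hD A hs m) := by
  rw [satSet, ZFSet.mem_sep, and_iff_right hu]
  constructor
  · rintro ⟨m', φ', s', hs', hp, h, H⟩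
    rw [pair_inj, num_inj] at h
    obtain ⟨h, rfl⟩ := h
    obtain ⟨rfl, h⟩ := Sigma.mk.inj_iff.1 (code_inj h)
    obtain rfl := eq_of_heq h
    exact ⟨hp, H⟩
  · rintro ⟨hp, H⟩
    exact ⟨m, φ, s, hs, hp, rfl, H⟩

/-- Formulas are evaluated in `D`, not in `V_o`. In the clause for bounded quantifiers the new value
is an element of a value of `s`, hence lies in `V_o`, and for limit `o` an updated assignment with
it exists in `V_o`. -/
lemma isSat_satSet {o : Ordinal.{u}} (ho : Order.IsSuccLimit o) (hoD : V_ o ⊆ D) :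
    IsSat A (V_ o) (satSet hD A (V_ o) fun _ => True) := by
  have hO := isAssignmentClosed_vonNeumann ho
  have key : ∀ {m : ℕ} (φ : (setLang Unit).BoundedFormula Empty m) {s : ZFSet.{u}}
      (hs : s ∈ V_ o), pair (num (code φ)) s ∈ satSet hD A (V_ o) (fun _ => True) ↔
        φ.Realize Empty.elim (asg hD A (hoD hs) m) := by
    intro m φ s hs
    rw [mem_satSet hD (hoD hs) (pair_mem_vonNeumann ho.isSuccPrelimit (hO.num_mem _) hs),
      true_and]
  constructor
  · rintro _ _ _ _ ⟨m, rfl⟩ s hs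
    rw [key _ hs]
    exact not_false
  · rintro _ _ _ _ ⟨m, t, t', rfl, rfl, rfl⟩ s hs
    rw [key _ hs, realize_equal_asg]
  · rintro _ _ _ _ ⟨m, ts, rfl, rfl, rfl⟩ s hs
    rw [key _ hs, realize_mem_asg]
  · rintro _ _ _ _ ⟨m, ts, rfl, rfl⟩ s hs
    rw [key _ hs, realize_pred_asg]
  · rintro _ _ _ _ ⟨m, φ, ψ, rfl, rfl, rfl⟩ s hs
    rw [key _ hs, key _ hs, key _ hs, BoundedFormula.realize_imp]
  · rintro _ _ m _ ⟨_, y, φ, rfl, rfl, rfl, rfl⟩ s hs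
    rw [key _ hs, realize_ball_asg]
    constructor
    · intro H t ht hst hty
      exact (key _ ht).2 (H t (hoD ht) hst hty)
    · intro H t ht hst hty
      have hx : val t (num m) ∈ V_ o :=
        hO.trans.subset_of_mem (hO.val_mem s hs _ (hO.num_mem y)) hty
      obtain ⟨w, hw, hsw, hwt⟩ := hO.exists_agree hs m hx
      have h1 := (key _ hw).1 (H w hw hsw (by rwa [hwt]))
      rwa [asg_congr hD _ ht] at h1
      intro i hi
      rcases Nat.lt_succ_iff_lt_or_eq.1 hi with hi | rfl
      · exact (hsw i hi).symm.trans (hst i hi)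
      · exact hwt
  · rintro _ _ m _ ⟨_, y, φ, rfl, rfl, rfl, rfl⟩ s hs x hx
    exact hO.exists_agree hs m (hO.trans.subset_of_mem (hO.val_mem s hs _ (hO.num_mem y)) hx)

end Semantics

end Coding

/-! ### Definability of truth -/

section Truth

variable {P ι : Type}

/-- The formula `val s i = val t j`. -/
def fValEq (s i t j : ι) : (setLang P).Formula ι :=
  fAll (BoundedFormula.iff (fPairMem (some i) none (some s)) (fPairMem (some j) none (some t)))

/-- The formula `x = val s i`. -/
def fIsVal (x s i : ι) : (setLang P).Formula ι :=
  fAll (BoundedFormula.iff (fMem none (some x)) (fPairMem (some i) none (some s)))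

/-- The formula expressing that the assignments `s` and `t` agree on `m`. -/
def fAgree (m s t : ι) : (setLang P).Formula ι :=
  fBAll m (fValEq (some s) none (some t) none)

/-- The formula expressing that `φ` holds for all quadruples in `p`. -/
def fForQuad (p : ι) (φ : (setLang P).Formula (Option (Option (Option (Option ι))))) :
    (setLang P).Formula ι :=
  fAll (fAll (fAll (fAll ((fQuadMem (some (some (some none))) (some (some none)) (some none) none
    (some (some (some (some p))))).imp φ))))

/-- The formula expressing that `φ` holds for some quadruple in `p` whose first entry is `k`. -/
def fExQuad (p k : ι) (φ : (setLang P).Formula (Option (Option (Option ι)))) :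
    (setLang P).Formula ι :=
  fEx (fEx (fEx (fQuadMem (some (some (some k))) (some (some none)) (some none) none
    (some (some (some p))) ⊓ φ)))

/-- The formula expressing `IsSat`, where `p` is the predicate symbol and the variables `q` stand
for the sets `synSet`. -/
def fSat (p : P) (q : SynKind → ι) (u S : ι) : (setLang P).Formula ι :=
  fForQuad (q .falsum) (fBAll (some (some (some (some u))))
    (∼ (fPairMem (some (some (some (some none)))) none (some (some (some (some (some S)))))))) ⊓
  (fForQuad (q .equal) (fBAll (some (some (some (some u)))) (BoundedFormula.iff
    (fPairMem (some (some (some (some none)))) none (some (some (some (some (some S))))))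
    (fValEq none (some (some (some none))) none (some (some none))))) ⊓
  (fForQuad (q .mem) (fBAll (some (some (some (some u)))) (BoundedFormula.iff
    (fPairMem (some (some (some (some none)))) none (some (some (some (some (some S))))))
    (fEx (fIsVal none (some none) (some (some (some (some none)))) ⊓
      fPairMem (some (some (some none))) none (some none))))) ⊓
  (fForQuad (q .pred) (fBAll (some (some (some (some u)))) (BoundedFormula.iff
    (fPairMem (some (some (some (some none)))) none (some (some (some (some (some S))))))
    (fEx (fIsVal none (some none) (some (some (some (some none)))) ⊓ fPred p none)))) ⊓
  (fForQuad (q .imp) (fBAll (some (some (some (some u)))) (BoundedFormula.iff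
    (fPairMem (some (some (some (some none)))) none (some (some (some (some (some S))))))
    ((fPairMem (some (some (some none))) none (some (some (some (some (some S)))))).imp
      (fPairMem (some (some none)) none (some (some (some (some (some S))))))))) ⊓
  (fForQuad (q .ball) (fBAll (some (some (some (some u)))) (BoundedFormula.iff
    (fPairMem (some (some (some (some none)))) none (some (some (some (some (some S))))))
    (fBAll (some (some (some (some (some u))))) ((fAgree (some (some (some none))) (some none)
      none).imp ((fEx (fIsVal none (some none) (some (some (some (some none)))) ⊓
        fPairMem (some (some (some none))) none (some (some none)))).imp
      (fPairMem (some (some (some (some none)))) none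
        (some (some (some (some (some (some S))))))))))) ) ⊓
  fForQuad (q .ball) (fBAll (some (some (some (some u)))) (fAll (BoundedFormula.imp
    (fPairMem (some (some none)) none (some none))
    (fBEx (some (some (some (some (some (some u))))))
      (fAgree (some (some (some (some none)))) (some (some none)) none ⊓
        fIsVal (some none) none (some (some (some (some none))))))))))))))

/-- The formula expressing that `k` is the code of a formula with at most `n` blocks of quantifiers
which holds for the assignment `s`. -/
def fTruth (p : P) : ℕ → ∀ {ι : Type}, (SynKind → ι) → ι → ι → (setLang P).Formula ι
  | 0, _, q, k, s => fExQuad (q .delta0) k ⊤ ⊓ fEx (fEx (fMem (some (some s)) (some none) ⊓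
      (fSat p (some ∘ some ∘ q) (some none) none ⊓ fPairMem (some (some k)) (some (some s)) none)))
  | n + 1, _, q, k, s =>
      fExQuad (q .allBlock) k (fAll ((fAgree (some (some none)) (some (some (some (some s))))
        none).imp (fTruth p n (some ∘ some ∘ some ∘ some ∘ q) (some (some (some none))) none))) ⊔
      fExQuad (q .exBlock) k (fEx (fAgree (some (some none)) (some (some (some (some s)))) none ⊓
        fTruth p n (some ∘ some ∘ some ∘ some ∘ q) (some (some (some none))) none))

/-- The formula expressing the closure conditions under which `fTruth` defines truth. -/
def fClosure (p : P) (q : SynKind → ι) : (setLang P).Formula ι :=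
  fAll (fAll (fEx (fIsVal none (some (some none)) (some none)))) ⊓
  (fAll (fAll (fAll (fEx (fAgree (some (some none)) (some (some (some none))) none ⊓
    fIsVal (some none) none (some (some none)))))) ⊓
  fAll (fEx (fEx (fMem (some (some none)) (some none) ⊓
    fSat p (some ∘ some ∘ some ∘ q) (some none) none))))

variable {D : ZFSet.{u}} {I : P → ZFSet.{u}} {v : ι → Str D I}

section Transitive

variable (hD : D.IsTransitive)
include hD

lemma realize_fValEq {s i t j : ι} :
    (fValEq (P := P) s i t j).Realize v ↔ val (v s).val (v i).val = val (v t).val (v j).val := by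
  simp only [fValEq, realize_fAll, realize_fIff, realize_fPairMem hD, vcons_none, vcons_some]
  rw [ZFSet.ext_iff]
  simp only [mem_val]
  refine ⟨fun H y => ⟨fun h => ?_, fun h => ?_⟩, fun H y _ => H y⟩
  · exact (H y (mem_of_pair_mem_right hD (hD.subset_of_mem (v s).mem h))).1 h
  · exact (H y (mem_of_pair_mem_right hD (hD.subset_of_mem (v t).mem h))).2 h

lemma realize_fIsVal {x s i : ι} :
    (fIsVal (P := P) x s i).Realize v ↔ val (v s).val (v i).val = (v x).val := by
  simp only [fIsVal, realize_fAll, realize_fIff, realize_fMem, realize_fPairMem hD, vcons_none,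
    vcons_some]
  rw [ZFSet.ext_iff]
  simp only [mem_val]
  refine ⟨fun H y => ⟨fun h => ?_, fun h => ?_⟩, fun H y _ => (H y).symm⟩
  · exact (H y (mem_of_pair_mem_right hD (hD.subset_of_mem (v s).mem h))).2 h
  · exact (H y (hD.subset_of_mem (v x).mem h)).1 h

lemma realize_fAgree {m s t : ι} : (fAgree (P := P) m s t).Realize v ↔
    ∀ i ∈ (v m).val, val (v s).val i = val (v t).val i := by
  simp only [fAgree, realize_fBAll, realize_fValEq hD, vcons_none, vcons_some]
  exact ⟨fun H i hi => H i (hD.subset_of_mem (v m).mem hi) hi, fun H i _ hi => H i hi⟩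

omit hD in
lemma agree_iff_forall_mem_num {m : ℕ} {s t : ZFSet.{u}} :
    (∀ i ∈ num m, val s i = val t i) ↔ Agree m s t := by
  constructor
  · exact fun H i hi => H _ (num_mem_num.2 hi)
  · intro H i hi
    obtain ⟨j, hj, rfl⟩ := mem_num.1 hi
    exact H j hj

lemma realize_fForQuad (hn : ∀ n, num n ∈ D) {p : ι} {k : SynKind} (hp : (v p).val = synSet k)
    {φ : (setLang P).Formula (Option (Option (Option (Option ι))))} :
    (fForQuad p φ).Realize v ↔ ∀ a b c d, SynRel k a b c d →
      φ.Realize (vcons ⟨num d, hn d⟩ (vcons ⟨num c, hn c⟩ (vcons ⟨num b, hn b⟩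
        (vcons ⟨num a, hn a⟩ v)))) := by
  simp only [fForQuad, realize_fAll, realize_fImp, realize_fQuadMem hD, vcons_none, vcons_some, hp,
    mem_synSet]
  constructor
  · exact fun H a b c d h => H _ (hn a) _ (hn b) _ (hn c) _ (hn d) ⟨a, b, c, d, h, rfl, rfl, rfl, rfl⟩
  · rintro H _ _ _ _ _ _ _ _ ⟨a, b, c, d, h, rfl, rfl, rfl, rfl⟩
    exact H a b c d h

lemma realize_fExQuad (hn : ∀ n, num n ∈ D) {p k : ι} {K : SynKind} (hp : (v p).val = synSet K)
    {φ : (setLang P).Formula (Option (Option (Option ι)))} :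
    (fExQuad p k φ).Realize v ↔ ∃ a b c d, SynRel K a b c d ∧ (v k).val = num a ∧
      φ.Realize (vcons ⟨num d, hn d⟩ (vcons ⟨num c, hn c⟩ (vcons ⟨num b, hn b⟩ v))) := by
  simp only [fExQuad, realize_fEx, Formula.realize_inf, realize_fQuadMem hD, vcons_none,
    vcons_some, hp, mem_synSet]
  constructor
  · rintro ⟨_, _, _, _, _, _, ⟨a, b, c, d, h, hk, rfl, rfl, rfl⟩, H⟩
    exact ⟨a, b, c, d, h, hk, H⟩
  · rintro ⟨a, b, c, d, h, hk, H⟩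
    exact ⟨_, hn b, _, hn c, _, hn d, ⟨a, b, c, d, h, hk, rfl, rfl, rfl⟩, H⟩

lemma realize_fSat (hn : ∀ n, num n ∈ D) (hval : ∀ s ∈ D, ∀ i ∈ D, val s i ∈ D) {p : P}
    {q : SynKind → ι} (hq : ∀ k, (v (q k)).val = synSet k) {w S : ι} :
    (fSat p q w S).Realize v ↔ IsSat (I p) (v w).val (v S).val := by
  have hw : ∀ {s}, s ∈ (v w).val → s ∈ D := fun h => hD.subset_of_mem (v w).mem h
  have hpm : ∀ {s i y}, s ∈ D → pair i y ∈ s → y ∈ D := fun hs h =>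
    mem_of_pair_mem_right hD (hD.subset_of_mem hs h)
  have hex : ∀ {s i : ZFSet.{u}} {r : ZFSet.{u} → Prop}, s ∈ D → i ∈ D →
      ((∃ x, ∃ _ : x ∈ D, val s i = x ∧ r x) ↔ r (val s i)) := fun hs hi =>
    ⟨by rintro ⟨_, _, rfl, h⟩; exact h, fun h => ⟨_, hval _ hs _ hi, rfl, h⟩⟩
  simp only [fSat, Formula.realize_inf, realize_fForQuad hD hn (hq _), realize_fBAll,
    Formula.realize_not, realize_fIff, realize_fImp, realize_fEx, realize_fAll, realize_fBEx,
    realize_fPred, realize_fPairMem hD, realize_fValEq hD, realize_fIsVal hD, realize_fAgree hD,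
    agree_iff_forall_mem_num, vcons_none, vcons_some]
  constructor
  · rintro ⟨h1, h2, h3, h4, h5, h6, h7⟩
    refine ⟨fun a b c d h s hs => h1 a b c d h s (hw hs) hs,
      fun a b c d h s hs => h2 a b c d h s (hw hs) hs, fun a b c d h s hs => ?_,
      fun a b c d h s hs => ?_, fun a b c d h s hs => h5 a b c d h s (hw hs) hs,
      fun a b c d h s hs => ?_, fun a b c d h s hs x hx => ?_⟩
    · rw [h3 a b c d h s (hw hs) hs, hex (hw hs) (hn b), mem_val]
    · rw [h4 a b c d h s (hw hs) hs, hex (hw hs) (hn b)]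
    · rw [h6 a b c d h s (hw hs) hs]
      refine ⟨fun H t ht hst hty => H t (hw ht) ht hst ((hex (hw ht) (hn c)).2 (mem_val.1 hty)),
        fun H t _ ht hst hty => H t ht hst (mem_val.2 ((hex (hw ht) (hn c)).1 hty))⟩
    · obtain ⟨t, -, ht, h⟩ := h7 a b c d h s (hw hs) hs x (hpm (hw hs) (mem_val.1 hx))
        (mem_val.1 hx)
      exact ⟨t, ht, h⟩
  · rintro ⟨h1, h2, h3, h4, h5, h6, h7⟩
    refine ⟨fun a b c d h s _ hs => h1 a b c d h s hs, fun a b c d h s _ hs => h2 a b c d h s hs,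
      fun a b c d h s _ hs => ?_, fun a b c d h s _ hs => ?_,
      fun a b c d h s _ hs => h5 a b c d h s hs, fun a b c d h s _ hs => ?_,
      fun a b c d h s _ hs x _ hx => ?_⟩
    · rw [h3 a b c d h s hs, hex (hw hs) (hn b), mem_val]
    · rw [h4 a b c d h s hs, hex (hw hs) (hn b)]
    · rw [h6 a b c d h s hs]
      refine ⟨fun H t _ ht hst hty => H t ht hst (mem_val.2 ((hex (hw ht) (hn c)).1 hty)),
        fun H t ht hst hty => H t (hw ht) ht hst ((hex (hw ht) (hn c)).2 (mem_val.1 hty))⟩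
    · obtain ⟨t, ht, h⟩ := h7 a b c d h s hs x (mem_val.2 hx)
      exact ⟨t, hw ht, ht, h⟩

/-- An extension `X` need not look like a level of the hierarchy, so the closure conditions needed
for coding assignments and for `Δ₀` truth are transferred to it as part of a sentence. -/
lemma realize_fClosure (hn : ∀ n, num n ∈ D) {p : P} {q : SynKind → ι}
    (hq : ∀ k, (v (q k)).val = synSet k) :
    (fClosure p q).Realize v ↔ IsAssignmentClosed D ∧
      ∀ s ∈ D, ∃ u ∈ D, ∃ S ∈ D, s ∈ u ∧ IsSat (I p) u S := by
  have hval : (∀ s ∈ D, ∀ i ∈ D, val s i ∈ D) ↔ ∀ s, s ∈ D → ∀ i, i ∈ D → ∃ x, ∃ _ : x ∈ D,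
      val s i = x :=
    ⟨fun H s hs i hi => ⟨_, H s hs i hi, rfl⟩, fun H s hs i hi => by
      obtain ⟨x, hx, h⟩ := H s hs i hi
      rwa [h]⟩
  simp only [fClosure, Formula.realize_inf, realize_fAll, realize_fEx, realize_fIsVal hD,
    realize_fAgree hD, realize_fMem, vcons_none, vcons_some]
  rw [← hval]
  constructor
  · rintro ⟨h1, h2, h3⟩
    refine ⟨⟨hD, hn, h1, fun s hs m hm x hx => ?_⟩, fun s hs => ?_⟩
    · obtain ⟨t, ht, h⟩ := h2 s hs m hm x hx
      exact ⟨t, ht, h⟩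
    · obtain ⟨w, hw, S, hS, hsw, h⟩ := h3 s hs
      exact ⟨w, hw, S, hS, hsw, (realize_fSat hD hn h1 (by exact hq)).1 h⟩
  · rintro ⟨h1, h2⟩
    refine ⟨h1.val_mem, fun s hs m hm x hx => ?_, fun s hs => ?_⟩
    · obtain ⟨t, ht, h⟩ := h1.update s hs m hm x hx
      exact ⟨t, ht, h⟩
    · obtain ⟨w, hw, S, hS, hsw, h⟩ := h2 s hs
      exact ⟨w, hw, S, hS, hsw, (realize_fSat hD hn h1.val_mem (by exact hq)).2 h⟩

end Transitive

/-- Truth of a fixed quantifier depth is definable by recursion on the depth: `Δ₀` truth through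
some satisfaction relation that is a set, and each further block through a quantifier over
assignments. -/
theorem realize_fTruth (hD : IsAssignmentClosed D) {p : P}
    (hsat : ∀ s ∈ D, ∃ u ∈ D, ∃ S ∈ D, s ∈ u ∧ IsSat (I p) u S) {n : ℕ} {ι : Type}
    {v : ι → Str D I} {q : SynKind → ι} (hq : ∀ k, (v (q k)).val = synSet k) {k s : ι} :
    (fTruth p n q k s).Realize v ↔
      ∃ (m : ℕ) (φ : (setLang Unit).BoundedFormula Empty m), HasBlocks n φ ∧
        (v k).val = num (code φ) ∧ φ.Realize Empty.elim (asg hD (I p) (v s).mem m) := by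
  have hT := hD.trans
  have hn := hD.num_mem
  induction n generalizing ι with
  | zero =>
    simp only [fTruth, Formula.realize_inf, realize_fExQuad hT hn (hq _), Formula.realize_top,
      and_true, realize_fEx, realize_fMem, realize_fPairMem hT, vcons_none, vcons_some, HasBlocks]
    constructor
    · rintro ⟨⟨_, _, _, _, ⟨m, φ, hφ, rfl⟩, hk⟩, w, hw, S, hS, hsw, h, hks⟩
      rw [realize_fSat hT hn hD.val_mem (by exact hq)] at h
      simp only [vcons_none, vcons_some] at h
      rw [hk, h.mem_iff hD hw hφ hsw] at hks
      exact ⟨m, φ, hφ, hk, hks⟩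
    · rintro ⟨m, φ, hφ, hk, H⟩
      obtain ⟨w, hw, S, hS, hsw, h⟩ := hsat _ (v s).mem
      refine ⟨⟨_, 0, 0, 0, ⟨m, φ, hφ, rfl⟩, hk⟩, w, hw, S, hS, hsw,
        (realize_fSat hT hn hD.val_mem (by exact hq)).2 h, ?_⟩
      rwa [hk, h.mem_iff hD hw hφ hsw]
  | succ n ih =>
    have key : ∀ (b c d : ℕ) (t : ZFSet.{u}) (ht : t ∈ D),
        (fTruth p n (some ∘ some ∘ some ∘ some ∘ q) (some (some (some none))) none).Realize
          (vcons ⟨t, ht⟩ (vcons ⟨num d, hn d⟩ (vcons ⟨num c, hn c⟩ (vcons ⟨num b, hn b⟩ v)))) ↔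
        ∃ (m : ℕ) (φ : (setLang Unit).BoundedFormula Empty m), HasBlocks n φ ∧
          b = code φ ∧ φ.Realize Empty.elim (asg hD (I p) ht m) := by
      intro b c d t ht
      refine (ih (by exact hq)).trans ?_
      simp only [vcons_none, vcons_some, num_inj]
    simp only [fTruth, Formula.realize_sup, realize_fExQuad hT hn (hq _), realize_fAll,
      realize_fImp, realize_fEx, Formula.realize_inf, key, realize_fAgree hT,
      agree_iff_forall_mem_num, vcons_none, vcons_some, HasBlocks]
    constructor
    · rintro (⟨_, _, m, _, ⟨_, l, φ, ψ, hb, rfl, rfl, rfl⟩, hk, H⟩ |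
        ⟨_, _, m, _, ⟨_, l, φ, ψ, hb, rfl, rfl, rfl⟩, hk, t, ht, hst, m', φ', h, hc, H⟩)
      -- The instance `t = s` of the universal statement shows that the matrix `ψ` has at most `n`
      -- blocks.
      · obtain ⟨m', φ', h, hc, -⟩ := H _ (v s).mem (agree_refl _ _)
        obtain ⟨rfl, hc'⟩ := Sigma.mk.inj_iff.1 (code_inj hc)
        obtain rfl := eq_of_heq hc'
        refine ⟨m, φ, ⟨l, ψ, h, .inl hb⟩, hk, (hb.realize_asg hD _).2 fun t ht hst => ?_⟩
        obtain ⟨m', φ', h, hc, H'⟩ := H t ht hst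
        obtain ⟨rfl, hc'⟩ := Sigma.mk.inj_iff.1 (code_inj hc)
        obtain rfl := eq_of_heq hc'
        exact H'
      · obtain ⟨rfl, hc'⟩ := Sigma.mk.inj_iff.1 (code_inj hc)
        obtain rfl := eq_of_heq hc'
        exact ⟨m, φ, ⟨l, ψ, h, .inr hb⟩, hk, (hb.realize_asg hD _).2 ⟨t, ht, hst, H⟩⟩
    · rintro ⟨m, φ, ⟨l, ψ, h, hb | hb⟩, hk, H⟩
      · exact .inl ⟨_, _, _, 0, ⟨m, l, φ, ψ, hb, rfl, rfl, rfl⟩, hk, fun t ht hst =>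
          ⟨l, ψ, h, rfl, (hb.realize_asg hD _).1 H t ht hst⟩⟩
      · obtain ⟨t, ht, hst, H⟩ := (hb.realize_asg hD _).1 H
        exact .inr ⟨_, _, _, 0, ⟨m, l, φ, ψ, hb, rfl, rfl, rfl⟩, hk, t, ht, hst, l, ψ, h, rfl, H⟩

end Truth

/-! ### From reflection to extensions -/

section Extension

/-- The witness for `u` is `V_ (rank s + ω)`: a limit level containing `s`, and below `κ` because
`κ` is closed under ordinal addition. -/
lemma exists_isSat_vonNeumann {κ : Cardinal.{u}} (hκ : κ.IsInaccessible) (A : ZFSet.{u}) :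
    ∀ s ∈ V_ κ.ord, ∃ u ∈ V_ κ.ord, ∃ S ∈ V_ κ.ord, s ∈ u ∧ IsSat A u S := by
  intro s hs
  have hlim := IsInaccessible.isSuccLimit_ord hκ
  have ho : Order.IsSuccLimit (rank s + Ordinal.omega0) := Ordinal.isSuccLimit_add _ Ordinal.isSuccLimit_omega0
  have hω : Ordinal.omega0 < κ.ord := by
    rw [Cardinal.lt_ord, Ordinal.card_omega0]
    exact hκ.aleph0_lt
  have hlt : rank s + Ordinal.omega0 < κ.ord :=
    Ordinal.isPrincipal_add_ord hκ.aleph0_lt.le (mem_vonNeumann.1 hs) hω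
  have hu : V_ (rank s + Ordinal.omega0) ∈ V_ κ.ord := by simpa using hlt
  refine ⟨_, hu, _, mem_vonNeumann_of_subset ZFSet.sep_subset hu, ?_,
    isSat_satSet (isAssignmentClosed_vonNeumann hlim) ho (vonNeumann_subset_of_le hlt.le)⟩
  rw [mem_vonNeumann]
  exact lt_add_of_pos_right _ Ordinal.omega0_pos

/-- The family of predicates consisting of `A`, `T` and the singletons of the sets `synSet`. -/
noncomputable def truthFamily (A T : ZFSet.{u}) : Fin (Nat.card SynKind + 2) → ZFSet.{u} :=
  Fin.cons A (Fin.cons T fun i => {synSet ((Finite.equivFin SynKind).symm i)})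

/-- The sentence expressing that the predicate `1` is the truth predicate for the formulas with at
most `n` blocks of quantifiers in the predicate `0`. -/
noncomputable def truthSentence (n : ℕ) : (setLang (Fin (Nat.card SynKind + 2))).Sentence :=
  Formula.iAlls SynKind (BoundedFormula.imp
    (Formula.iInf fun k : SynKind => (fPred (Finite.equivFin SynKind k).succ.succ (.inr k) :
      (setLang (Fin (Nat.card SynKind + 2))).Formula (Empty ⊕ SynKind)))
    (fClosure (P := Fin (Nat.card SynKind + 2)) 0 Sum.inr ⊓ fAll (fAll (BoundedFormula.iff (fPairPred (P := Fin (Nat.card SynKind + 2)) 1 (some none) none)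
      (fTruth (P := Fin (Nat.card SynKind + 2)) 0 n (some ∘ some ∘ Sum.inr) (some none) none)))))

/-- There are no constants, so the sets `synSet k` are named by singleton predicates and quantified
universally. In an extension such a predicate may gain elements, but it still contains `synSet k`,
at which the sentence can be instantiated. -/
lemma realize_truthSentence {D : ZFSet.{u}} {I : Fin (Nat.card SynKind + 2) → ZFSet.{u}}
    {n : ℕ} : Str D I ⊨ truthSentence n ↔ ∀ c : SynKind → Str D I,
      (∀ k, (c k).val ∈ I (Finite.equivFin SynKind k).succ.succ) →
        (fClosure (P := Fin (Nat.card SynKind + 2)) (ι := Empty ⊕ SynKind) 0 Sum.inr).Realize (Sum.elim default c) ∧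
        ∀ k (hk : k ∈ D) s (hs : s ∈ D),
          (fPairPred (P := Fin (Nat.card SynKind + 2)) 1 (some none) none).Realize
            (vcons (⟨s, hs⟩ : Str D I) (vcons ⟨k, hk⟩ (Sum.elim (default : Empty → Str D I) c))) ↔
          (fTruth (P := Fin (Nat.card SynKind + 2)) 0 n (some ∘ some ∘ Sum.inr) (some none) none).Realize
            (vcons (⟨s, hs⟩ : Str D I) (vcons ⟨k, hk⟩ (Sum.elim (default : Empty → Str D I) c))) := by
  simp only [Sentence.Realize, truthSentence, Formula.realize_iAlls, realize_fImp,
    Formula.realize_iInf, realize_fPred, Sum.elim_inr, Formula.realize_inf, realize_fAll,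
    realize_fIff]

lemma isDefinableSubset_singleton {D x : ZFSet.{u}} (hx : x ∈ D) : IsDefinableSubset D {x} := by
  refine isDefinableSubset_of_formula (P := Empty) (I := Empty.elim) (ι := Unit)
    (fun p => p.elim) (fEq none (some ())) (fun _ => ⟨x, hx⟩) ?_ fun y hy => ?_
  · intro y hy
    rwa [ZFSet.mem_singleton.1 hy]
  · simp

theorem IsPi11Reflecting.hasExtensionProperty {κ : Cardinal.{u}} (h : IsPi11Reflecting κ) :
    HasExtensionProperty κ := by
  intro n A hA
  have hκ := h.1
  have hlim := IsInaccessible.isSuccLimit_ord hκ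
  have hV := isAssignmentClosed_vonNeumann hlim
  have hpair := fun {x y : ZFSet.{u}} => pair_mem_vonNeumann hlim.isSuccPrelimit (x := x) (y := y)
  have hsat := exists_isSat_vonNeumann hκ A
  let T := satSet hV A (V_ κ.ord) (HasBlocks n)
  -- The defining formula of `T` mentions `A`, which is itself definable over `(V_κ, ∈)`; this makes
  -- `T` admissible for reflection.
  have hTdef : IsDefinableSubset (V_ κ.ord) T := by
    refine isDefinableSubset_of_formula (P := Unit) (I := fun _ => A) (ι := SynKind)
      (fun _ => hA) (fEx (fEx (fPair (some none) none (some (some none)) ⊓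
        fTruth () n (some ∘ some ∘ some) (some none) none)))
      (fun k => ⟨synSet k, synSet_mem_vonNeumann hκ k⟩) ZFSet.sep_subset fun x hx => ?_
    have key : ∀ (k : ZFSet.{u}) (hk : k ∈ V_ κ.ord) (s : ZFSet.{u}) (hs : s ∈ V_ κ.ord) v,
        (fTruth () n (some ∘ some ∘ some) (some none) none).Realize
        (vcons (⟨s, hs⟩ : Str (V_ κ.ord) (fun _ : Unit => A)) (vcons ⟨k, hk⟩ (vcons v
          (fun k => ⟨synSet k, synSet_mem_vonNeumann hκ k⟩)))) ↔ _ :=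
      fun k hk s hs v => realize_fTruth hV (p := ()) hsat (by exact fun k => rfl)
    simp only [realize_fEx, Formula.realize_inf, realize_fPair hV.trans, key, vcons_none,
      vcons_some]
    constructor
    · intro hxT
      obtain ⟨-, m, φ, s, hs, h1, rfl, h2⟩ := ZFSet.mem_sep.1 hxT
      exact ⟨_, hV.num_mem _, s, hs, rfl, m, φ, h1, rfl, h2⟩
    · rintro ⟨_, _, s, hs, rfl, m, φ, h1, rfl, h2⟩
      exact (mem_satSet hV hs hx).2 ⟨h1, h2⟩
  have hI : ∀ i, IsDefinableSubset (V_ κ.ord) (truthFamily A T i) := by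
    refine Fin.cases hA (Fin.cases hTdef fun i => ?_)
    exact isDefinableSubset_singleton (synSet_mem_vonNeumann hκ _)
  have htrue : Str (V_ κ.ord) (truthFamily A T) ⊨ truthSentence n := by
    rw [realize_truthSentence]
    intro c hc
    have hc' : ∀ k, (c k).val = synSet k := by
      intro k
      have := hc k
      simpa [truthFamily] using this
    refine ⟨(realize_fClosure hV.trans hV.num_mem (by exact hc')).2 ⟨hV, hsat⟩,
      fun k hk s hs => ?_⟩
    rw [realize_fTruth hV hsat (by exact hc'), realize_fPairPred hV.trans]
    simp only [vcons_none, vcons_some]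
    rw [and_iff_right (hpair hk hs)]
    change pair k s ∈ T ↔ _
    constructor
    · intro hT
      obtain ⟨-, m, φ, s', hs', h1, h2, h3⟩ := ZFSet.mem_sep.1 hT
      rw [pair_inj] at h2
      obtain ⟨rfl, rfl⟩ := h2
      exact ⟨m, φ, h1, rfl, h3⟩
    · rintro ⟨m, φ, h1, rfl, h2⟩
      exact (mem_satSet hV hs (hpair hk hs)).2 ⟨h1, h2⟩
  obtain ⟨X, I', hX, hI'X, hκX, hsub, hII', hXtrue⟩ := h.exists_extension hI _ htrue
  refine ⟨X, I' 0, hX, hI'X 0, hκX, hsub, fun m φ hφ v => ?_⟩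
  obtain ⟨hcl, hiff⟩ := realize_truthSentence.1 hXtrue
    (fun k => ⟨synSet k, hsub (synSet_mem_vonNeumann hκ k)⟩) (fun k => by
      rw [hII' _ _ (synSet_mem_vonNeumann hκ k)]
      simp [truthFamily])
  obtain ⟨hXc, hXsat⟩ := (realize_fClosure hX (fun n => hsub (hV.num_mem n))
    (by exact fun k => rfl)).1 hcl
  -- The tuple is coded by a single `s ∈ V_κ`, so that the pair of `code φ` and `s` lies in `V_κ`,
  -- where `T` and its extension `I' 1` agree.
  obtain ⟨s, hs, rfl⟩ := exists_asg_eq hV v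
  have hp : pair (num (code φ)) s ∈ V_ κ.ord := hpair (hV.num_mem _) hs
  have h1 := hiff _ (hXc.num_mem (code φ)) s (hsub hs)
  rw [realize_fTruth hXc hXsat (by exact fun k => rfl), realize_fPairPred hX] at h1
  simp only [vcons_none, vcons_some, hsub hp, true_and] at h1
  rw [hII' _ _ hp] at h1
  change pair (num (code φ)) s ∈ T ↔ _ at h1
  rw [mem_satSet hV hs hp, and_iff_right hφ.hasBlocks] at h1
  rw [h1]
  constructor
  · rintro ⟨m', φ', -, hc, H⟩
    obtain ⟨rfl, hc'⟩ := Sigma.mk.inj_iff.1 (code_inj (num_inj.1 hc))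
    obtain rfl := eq_of_heq hc'
    exact H
  · exact fun H => ⟨m, φ, hφ.hasBlocks, rfl, H⟩

end Extension

end SetReflection

theorem theorem3p2 (κ : Cardinal.{u}) :
    SetReflection.IsPi11Reflecting κ ↔
      κ.IsInaccessible ∧ SetReflection.HasExtensionProperty κ :=
  ⟨fun h => ⟨h.1, h.hasExtensionProperty⟩,
    fun h => SetReflection.isPi11Reflecting_of_hasExtensionProperty h.1 h.2⟩
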